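/- Let $\mathbb K$ be the field of locally convergent generalized Puiseux series $\alpha(t)=\sum_{r\in R}\alpha_r t^r$ ($R\subset\mathbb R$ well-ordered, $\alpha_r\in\mathbb C$, the series absolutely convergent for all small enough $t>0$), with valuation $\mathrm{val}(\alpha)=\min\{r:\alpha_r\ne0\}$ for $\alpha\neq 0$ and coefficientwise complex conjugation. A series is real if all $\alpha_r$ are real; its sign is then the sign of its leading coefficient. Put $\mathrm{Trop}(z,w)=(-\mathrm{val}(z),-\mathrm{val}(w))$ for $(z,w)\in(\mathbb K^\times)^2$. A tropical curve $C\subset\mathbb R^2$ is the corner locus of a tropical polynomial $P(x,y)=\max_{(i,j)\in A}(a_{ij}+ix+jy)$ ($A\subset\mathbb Z_{\ge0}^2$ finite), as a polyhedral complex with closed edges. An edge has as weight the maximum of $\gcd(|i-k|,|j-l|)$ over all pairs of exponents $(i,j),(k,l)$ whose monomials equal $P$ on it. The cells of its dual subdivision are the polygons $\Delta_P(x)$, the convex hulls of the exponents attaining the maximum at $x$. $C$ is non-singular if every two-dimensional cell is a triangle of area $1/2$ and all edges have weight one (the latter being automatic if the Newton polygon is two-dimensional). If $\delta$ is a distribution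 of signs $\pm1$ on the exponents, then for an edge $e$ of $C$ let $\mathcal E_e\subset(\mathbb Z/2)^2$ be the set of all $\varepsilon=(\varepsilon_1,\varepsilon_2)$ such that $(-1)^{\varepsilon_1i+\varepsilon_2j}\delta(i,j)$ takes different values at the two endpoints of the edge of the dual subdivision dual to $e$. A non-singular real tropical curve $(C,\mathcal E)$ is a non-singular tropical curve with a family $\mathcal E=(\mathcal E_e)_e$ that arises from some $\delta$ in this way. A realisation of $(C,\mathcal E)$ is a curve $\mathcal C=\{F=0\}\subset(\mathbb K^\times)^2$, where $F\in\mathbb K[z,w]$ has real coefficients, such that the tropicalisation of $\mathcal C$ (its image under $\mathrm{Trop}$, with the edges and weights of the tropical polynomial with coefficients $-\mathrm{val}(\text{coefficients of }F)$) is $C$, and the signs of the coefficients of $F$ induce $\mathcal E$. Let $(C,\mathcal E)$ and $(C',\mathcal E')$ be non-singular real tropical curves, defined by tropical polynomials $P,P'$. Let $u$ be a transverse intersection point, that is, an isolated point of $C\cap C'$ lying in the relative interior of an edge $e$ of $C$ and in the relative interior of an edge $e'$ of $C'$. Let $m\ge1$ be its tropical intersection multiplicity, i.e. the area of the cell $\Delta_P(u)+\Delta_{P'}(u)$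 dual to $u$ in the mixed subdivision of $C\cup C'$. Then for all realisations $\mathcal C$ of $(C,\mathcal E)$ and $\mathcal C'$ of $(C',\mathcal E')$ there are exactly $m$ distinct points $p\in\mathcal C\cap\mathcal C'$ with $\mathrm{Trop}(p)=u$. Moreover: - if $m$ is even, the set of these points consists of $2$ real points and $\frac{m-2}2$ pairs of complex conjugated points if and only if $\mathcal E_e=\mathcal E'_{e'}$, and it consists of $\frac m2$ pairs of complex conjugated points if and only if $\mathcal E_e\ne\mathcal E'_{e'}$; - if $m$ is odd, it consists of $1$ real point and $\frac{m-1}2$ pairs of complex conjugated points. -/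

import Mathlib

open scoped Pointwise

noncomputable section

namespace RealTropical

/-! ### Locally convergent generalized Puiseux series -/

/-- A formal series `∑ αᵣ tʳ` with well-ordered set of real exponents and complex coefficients
is locally convergent if it is (absolutely) convergent for all small enough `t > 0`. -/
def LocallyConvergent (x : HahnSeries ℝ ℂ) : Prop :=
  ∃ t₀ : ℝ, 0 < t₀ ∧ ∀ t : ℝ, 0 < t → t < t₀ →
    Summable fun r : ℝ => x.coeff r * ((t ^ r : ℝ) : ℂ)

theorem locallyConvergent_iff {x : HahnSeries ℝ ℂ} :
    LocallyConvergent x ↔ ∃ t₀ : ℝ, 0 < t₀ ∧ ∀ t : ℝ, 0 < t → t < t₀ →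
      Summable fun r : ℝ => ‖x.coeff r‖ * t ^ r := by
  unfold LocallyConvergent
  refine exists_congr fun t₀ => and_congr_right fun _ => forall_congr' fun t =>
    forall_congr' fun ht => forall_congr' fun _ => ?_
  rw [← summable_norm_iff]
  refine summable_congr fun r => ?_
  rw [norm_mul, Complex.norm_real, Real.norm_of_nonneg (Real.rpow_nonneg ht.le r)]

theorem mul_finite_bound (x y : HahnSeries ℝ ℂ) {t : ℝ} (ht : 0 < t) (F : Finset ℝ) :
    ∃ A B : Finset ℝ, (∀ a ∈ A, a ∈ x.support) ∧
      (∀ b ∈ B, b ∈ y.support ∧ ∃ g ∈ F, ∃ a ∈ A, a + b = g) ∧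
      ∑ g ∈ F, ‖(x * y).coeff g‖ * t ^ g ≤
        (∑ a ∈ A, ‖x.coeff a‖ * t ^ a) * ∑ b ∈ B, ‖y.coeff b‖ * t ^ b := by
  classical
  let anti : ℝ → Finset (ℝ × ℝ) := fun g =>
    Finset.antidiagonal x.isPWO_support y.isPWO_support g
  have hanti : ∀ g p, p ∈ anti g ↔ p.1 ∈ x.support ∧ p.2 ∈ y.support ∧ p.1 + p.2 = g := by
    intro g p
    simp only [anti, Finset.mem_antidiagonal]
  let D := F.biUnion anti
  let f : ℝ × ℝ → ℝ := fun p => (‖x.coeff p.1‖ * t ^ p.1) * (‖y.coeff p.2‖ * t ^ p.2)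
  have hf : ∀ p, 0 ≤ f p := fun p => by positivity
  refine ⟨D.image Prod.fst, D.image Prod.snd, ?_, ?_, ?_⟩
  · intro a ha
    obtain ⟨p, hp, rfl⟩ := Finset.mem_image.1 ha
    obtain ⟨g, -, hg⟩ := Finset.mem_biUnion.1 hp
    exact ((hanti g p).1 hg).1
  · intro b hb
    obtain ⟨p, hp, rfl⟩ := Finset.mem_image.1 hb
    obtain ⟨g, hgF, hg⟩ := Finset.mem_biUnion.1 hp
    have h := (hanti g p).1 hg
    exact ⟨h.2.1, g, hgF, p.1, Finset.mem_image_of_mem _ hp, h.2.2⟩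
  · calc ∑ g ∈ F, ‖(x * y).coeff g‖ * t ^ g
        ≤ ∑ g ∈ F, ∑ p ∈ anti g, f p := by
          refine Finset.sum_le_sum fun g _ => ?_
          rw [HahnSeries.coeff_mul]
          calc ‖∑ p ∈ anti g, x.coeff p.1 * y.coeff p.2‖ * t ^ g
              ≤ (∑ p ∈ anti g, ‖x.coeff p.1 * y.coeff p.2‖) * t ^ g := by
                gcongr
                exact norm_sum_le _ _
            _ = ∑ p ∈ anti g, f p := by
                rw [Finset.sum_mul]
                refine Finset.sum_congr rfl fun p hp => ?_
                rw [← ((hanti g p).1 hp).2.2, Real.rpow_add ht, norm_mul]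
                simp only [f]
                ring
      _ = ∑ p ∈ D, f p := by
          refine (Finset.sum_biUnion ?_).symm
          intro g _ g' _ hgg
          refine Finset.disjoint_left.2 fun p hp hp' => hgg ?_
          rw [← ((hanti g p).1 hp).2.2, ← ((hanti g' p).1 hp').2.2]
      _ ≤ ∑ p ∈ D.image Prod.fst ×ˢ D.image Prod.snd, f p := by
          refine Finset.sum_le_sum_of_subset_of_nonneg ?_ fun p _ _ => hf p
          intro p hp
          exact Finset.mem_product.2
            ⟨Finset.mem_image_of_mem _ hp, Finset.mem_image_of_mem _ hp⟩
      _ = _ := by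
          rw [Finset.sum_product, Finset.sum_mul_sum]

theorem LocallyConvergent.mul {x y : HahnSeries ℝ ℂ} (hx : LocallyConvergent x)
    (hy : LocallyConvergent y) : LocallyConvergent (x * y) := by
  rw [locallyConvergent_iff] at *
  obtain ⟨a, ha, hx⟩ := hx
  obtain ⟨b, hb, hy⟩ := hy
  refine ⟨min a b, lt_min ha hb, fun t ht hlt => ?_⟩
  have hx := hx t ht (hlt.trans_le (min_le_left _ _))
  have hy := hy t ht (hlt.trans_le (min_le_right _ _))
  have hnn : ∀ (z : HahnSeries ℝ ℂ) (r : ℝ), 0 ≤ ‖z.coeff r‖ * t ^ r := fun z r => by positivity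
  refine summable_of_sum_le (hnn _)
    (c := (∑' r, ‖x.coeff r‖ * t ^ r) * ∑' r, ‖y.coeff r‖ * t ^ r) fun F => ?_
  obtain ⟨A, B, -, -, h⟩ := mul_finite_bound x y ht F
  refine h.trans (mul_le_mul (hx.sum_le_tsum A fun i _ => hnn x i)
    (hy.sum_le_tsum B fun i _ => hnn y i) (Finset.sum_nonneg fun i _ => hnn y i)
    (tsum_nonneg (hnn x)))

theorem LocallyConvergent.add {x y : HahnSeries ℝ ℂ} (hx : LocallyConvergent x)
    (hy : LocallyConvergent y) : LocallyConvergent (x + y) := by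
  obtain ⟨a, ha, hx⟩ := hx
  obtain ⟨b, hb, hy⟩ := hy
  refine ⟨min a b, lt_min ha hb, fun t ht hlt => ?_⟩
  have := (hx t ht (hlt.trans_le (min_le_left _ _))).add
    (hy t ht (hlt.trans_le (min_le_right _ _)))
  simpa [HahnSeries.coeff_add, add_mul] using this

theorem LocallyConvergent.neg {x : HahnSeries ℝ ℂ} (hx : LocallyConvergent x) :
    LocallyConvergent (-x) := by
  obtain ⟨a, ha, hx⟩ := hx
  refine ⟨a, ha, fun t ht hlt => ?_⟩
  simpa [HahnSeries.coeff_neg, neg_mul] using (hx t ht hlt).neg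

theorem locallyConvergent_single (r : ℝ) (c : ℂ) :
    LocallyConvergent (HahnSeries.single r c) := by
  refine ⟨1, one_pos, fun t _ _ => ?_⟩
  refine summable_of_ne_finset_zero (s := {r}) fun s hs => ?_
  rw [HahnSeries.coeff_single_of_ne (by simpa using hs), zero_mul]

theorem locallyConvergent_one : LocallyConvergent 1 := locallyConvergent_single 0 1

theorem locallyConvergent_inv_one_sub {e : HahnSeries ℝ ℂ} (he : LocallyConvergent e)
    {r₀ : ℝ} (hr₀ : 0 < r₀) (her : ∀ r ∈ e.support, r₀ ≤ r) :
    LocallyConvergent (1 - e)⁻¹ := by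
  classical
  rw [locallyConvergent_iff] at *
  obtain ⟨t₀, ht₀, he⟩ := he
  set y := (1 - e)⁻¹ with hy
  have hne : (1 : HahnSeries ℝ ℂ) - e ≠ 0 := by
    intro h
    have h1 : (0 : ℝ) ∈ e.support := by
      rw [← sub_eq_zero.1 h]
      simp
    exact absurd (her 0 h1) (not_le.2 hr₀)
  have hyeq : y = 1 + e * y := by
    have := mul_inv_cancel₀ hne
    rw [← hy] at this
    linear_combination this
  have hnn : ∀ (z : HahnSeries ℝ ℂ) (t : ℝ), 0 < t → ∀ r : ℝ, 0 ≤ ‖z.coeff r‖ * t ^ r :=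
    fun z t ht r => by positivity
  have ht1 : 0 < t₀ / 2 := by positivity
  have hs1 := he (t₀ / 2) ht1 (by linarith)
  set M := ∑' r, ‖e.coeff r‖ * (t₀ / 2) ^ r with hM
  have hM0 : 0 ≤ M := tsum_nonneg (hnn e _ ht1)
  set s₀ : ℝ := min 1 ((1 / (2 * (M + 1))) ^ (1 / r₀)) with hs₀
  have hs₀pos : 0 < s₀ := lt_min one_pos (by positivity)
  refine ⟨t₀ / 2 * s₀, by positivity, fun t ht hlt => ?_⟩
  obtain ⟨s, hs⟩ : ∃ s, s = t / (t₀ / 2) := ⟨_, rfl⟩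
  have hspos : 0 < s := by rw [hs]; positivity
  have hts : t = t₀ / 2 * s := by rw [hs]; field_simp
  have hslt : s < s₀ := by
    rw [hts] at hlt
    exact lt_of_mul_lt_mul_left hlt ht1.le
  have hs1' : s ≤ 1 := hslt.le.trans (min_le_left _ _)
  have hsr : s ^ r₀ ≤ 1 / (2 * (M + 1)) := by
    have h1 : s ≤ (1 / (2 * (M + 1))) ^ (1 / r₀) := hslt.le.trans (min_le_right _ _)
    calc s ^ r₀ ≤ ((1 / (2 * (M + 1))) ^ (1 / r₀)) ^ r₀ :=
          Real.rpow_le_rpow hspos.le h1 hr₀.le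
      _ = 1 / (2 * (M + 1)) := by
          rw [← Real.rpow_mul (by positivity), one_div_mul_cancel hr₀.ne', Real.rpow_one]
  have heA : ∀ A : Finset ℝ, (∀ a ∈ A, a ∈ e.support) →
      ∑ a ∈ A, ‖e.coeff a‖ * t ^ a ≤ 1 / 2 := by
    intro A hA
    calc ∑ a ∈ A, ‖e.coeff a‖ * t ^ a
        ≤ ∑ a ∈ A, (‖e.coeff a‖ * (t₀ / 2) ^ a) * s ^ r₀ := by
          refine Finset.sum_le_sum fun a ha => ?_
          rw [hts, Real.mul_rpow ht1.le hspos.le, ← mul_assoc]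
          exact mul_le_mul_of_nonneg_left
            (Real.rpow_le_rpow_of_exponent_ge hspos hs1' (her a (hA a ha))) (by positivity)
      _ = (∑ a ∈ A, ‖e.coeff a‖ * (t₀ / 2) ^ a) * s ^ r₀ := by rw [Finset.sum_mul]
      _ ≤ M * (1 / (2 * (M + 1))) := by
          refine mul_le_mul (hs1.sum_le_tsum A fun i _ => hnn e _ ht1 i) hsr (by positivity) hM0
      _ ≤ 1 / 2 := by
          rw [mul_one_div, div_le_div_iff₀ (by positivity) (by norm_num)]
          linarith
  have key : ∀ g ∈ y.support, ∀ F : Finset ℝ, (∀ h ∈ F, h ∈ y.support ∧ h ≤ g) →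
      ∑ h ∈ F, ‖y.coeff h‖ * t ^ h ≤ 2 := by
    intro g hg
    refine Set.WellFoundedOn.induction y.isWF_support hg (P := fun g => ∀ F : Finset ℝ,
      (∀ h ∈ F, h ∈ y.support ∧ h ≤ g) → ∑ h ∈ F, ‖y.coeff h‖ * t ^ h ≤ 2) ?_
    intro g hg ih F hF
    obtain ⟨A, B, hA, hB, hAB⟩ := mul_finite_bound e y ht F
    have hB2 : ∑ b ∈ B, ‖y.coeff b‖ * t ^ b ≤ 2 := by
      rcases B.eq_empty_or_nonempty with rfl | hBne
      · simp
      · have hmax := B.max'_mem hBne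
        obtain ⟨hms, g', hg', a, ha, hag⟩ := hB _ hmax
        have hlt : B.max' hBne < g := by
          have h1 := her a (hA a ha)
          have h2 := (hF g' hg').2
          linarith
        exact ih _ hms hlt B fun h hh => ⟨(hB h hh).1, B.le_max' h hh⟩
    have h1 : ∑ h ∈ F, ‖(1 : HahnSeries ℝ ℂ).coeff h‖ * t ^ h ≤ 1 := by
      calc ∑ h ∈ F, ‖(1 : HahnSeries ℝ ℂ).coeff h‖ * t ^ h
          = ∑ h ∈ F, if h = 0 then (1 : ℝ) else 0 := by
            refine Finset.sum_congr rfl fun h _ => ?_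
            rw [HahnSeries.coeff_one]
            split_ifs with h0 <;> simp [h0]
        _ ≤ 1 := by
            rw [Finset.sum_ite_eq']
            split_ifs <;> norm_num
    calc ∑ h ∈ F, ‖y.coeff h‖ * t ^ h
        ≤ ∑ h ∈ F, (‖(1 : HahnSeries ℝ ℂ).coeff h‖ * t ^ h + ‖(e * y).coeff h‖ * t ^ h) := by
          refine Finset.sum_le_sum fun h _ => ?_
          rw [← add_mul]
          refine mul_le_mul_of_nonneg_right ?_ (by positivity)
          conv_lhs => rw [hyeq, HahnSeries.coeff_add]
          exact norm_add_le _ _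
      _ = ∑ h ∈ F, ‖(1 : HahnSeries ℝ ℂ).coeff h‖ * t ^ h +
            ∑ h ∈ F, ‖(e * y).coeff h‖ * t ^ h := Finset.sum_add_distrib
      _ ≤ 1 + 1 / 2 * 2 := by
          refine add_le_add h1 (hAB.trans (mul_le_mul (heA A hA) hB2 ?_ (by norm_num)))
          exact Finset.sum_nonneg fun i _ => hnn y t ht i
      _ = 2 := by norm_num
  refine summable_of_sum_le (hnn y t ht) (c := 2) fun F => ?_
  have hsub : ∑ h ∈ F.filter (· ∈ y.support), ‖y.coeff h‖ * t ^ h =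
      ∑ h ∈ F, ‖y.coeff h‖ * t ^ h := by
    refine Finset.sum_filter_of_ne fun h _ hh => ?_
    intro h0
    exact hh (by rw [h0]; simp)
  rw [← hsub]
  rcases (F.filter (· ∈ y.support)).eq_empty_or_nonempty with hF | hF
  · rw [hF]; simp
  · exact key _ (Finset.mem_filter.1 (Finset.max'_mem _ hF)).2 _ fun h hh =>
      ⟨(Finset.mem_filter.1 hh).2, Finset.le_max' _ h hh⟩

theorem LocallyConvergent.inv {x : HahnSeries ℝ ℂ} (hx : LocallyConvergent x) :
    LocallyConvergent x⁻¹ := by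
  rcases eq_or_ne x 0 with rfl | hx0
  · simpa using hx
  set m : HahnSeries ℝ ℂ := HahnSeries.single (-x.order) x.leadingCoeff⁻¹ with hm
  have hm0 : m ≠ 0 := HahnSeries.single_ne_zero (inv_ne_zero (HahnSeries.leadingCoeff_ne_zero.2 hx0))
  have hmc : LocallyConvergent m := locallyConvergent_single _ _
  have hcoeff : ∀ r, (m * x).coeff r = x.leadingCoeff⁻¹ * x.coeff (r + x.order) := by
    intro r
    rw [hm, HahnSeries.coeff_single_mul, sub_neg_eq_add]
  set e : HahnSeries ℝ ℂ := 1 - m * x with he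
  have hec : LocallyConvergent e := by
    rw [he, sub_eq_add_neg]
    exact locallyConvergent_one.add (hmc.mul hx).neg
  have hpos : ∀ r ∈ e.support, 0 < r := by
    intro r hr
    rw [HahnSeries.mem_support, he, HahnSeries.coeff_sub, hcoeff, HahnSeries.coeff_one] at hr
    rcases lt_trichotomy r 0 with h | h | h
    · rw [if_neg h.ne, HahnSeries.coeff_eq_zero_of_lt_order (by linarith)] at hr
      simp at hr
    · rw [if_pos h, h, zero_add, ← HahnSeries.leadingCoeff_eq,
        inv_mul_cancel₀ (HahnSeries.leadingCoeff_ne_zero.2 hx0)] at hr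
      simp at hr
    · exact h
  have hinv : LocallyConvergent (1 - e)⁻¹ := by
    rcases eq_or_ne e 0 with h0 | h0
    · rw [h0, sub_zero, inv_one]
      exact locallyConvergent_one
    · refine locallyConvergent_inv_one_sub hec (r₀ := e.order) ?_ ?_
      · exact hpos _ (fun h => h0 (HahnSeries.coeff_order_eq_zero.1 h))
      · intro r hr
        exact HahnSeries.order_le_of_coeff_ne_zero hr
  have hxe : x⁻¹ = m * (1 - e)⁻¹ := by
    rw [he, sub_sub_cancel, mul_inv, ← mul_assoc, mul_inv_cancel₀ hm0, one_mul]
  rw [hxe]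
  exact hmc.mul hinv

/-- The field of locally convergent generalized Puiseux series. -/
def puiseux : Subfield (HahnSeries ℝ ℂ) where
  carrier := {x | LocallyConvergent x}
  mul_mem' := LocallyConvergent.mul
  one_mem' := locallyConvergent_one
  add_mem' := LocallyConvergent.add
  zero_mem' := by
    have := locallyConvergent_single 0 0
    simpa using this
  neg_mem' := LocallyConvergent.neg
  inv_mem' := fun _ => LocallyConvergent.inv

/-- The field of locally convergent generalized Puiseux series, as a type. -/
abbrev 𝕂 : Type := puiseux

theorem LocallyConvergent.map_star {x : HahnSeries ℝ ℂ} (hx : LocallyConvergent x) :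
    LocallyConvergent (x.map (starRingEnd ℂ)) := by
  rw [locallyConvergent_iff] at *
  simpa using hx

namespace 𝕂

/-- A series is real if all its coefficients are real. -/
def IsReal (x : 𝕂) : Prop := ∀ r : ℝ, (x.1.coeff r).im = 0

/-- Complex conjugation on `𝕂`, coefficient by coefficient. -/
def conj (x : 𝕂) : 𝕂 := ⟨x.1.map (starRingEnd ℂ), LocallyConvergent.map_star x.2⟩

/-- The valuation of a nonzero series: the least exponent with nonzero coefficient.
It is only used at nonzero series; the value `0` at the zero series has no meaning. -/
def val (x : 𝕂) : ℝ := x.1.order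

/-- The sign of a nonzero real series: the sign of its leading coefficient. -/
def sign (x : 𝕂) : ℤˣ := if 0 < x.1.leadingCoeff.re then 1 else -1

end 𝕂

/-! ### Tropical polynomials and tropical curves in the plane -/

/-- A tropical polynomial `max_{α ∈ A} (a_α + α₀ x₀ + α₁ x₁)` in two variables: `A` is the finite
set of exponents whose coefficient is not `-∞`. Only the values of `coeff` on `A` matter. -/
structure TropPoly where
  support : Finset (Fin 2 →₀ ℕ)
  coeff : (Fin 2 →₀ ℕ) → ℝ

namespace TropPoly

variable (P : TropPoly)

/-- The value at `x` of the tropical monomial of exponent `α`. -/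
def term (α : Fin 2 →₀ ℕ) (x : Fin 2 → ℝ) : ℝ := P.coeff α + ∑ i, (α i : ℝ) * x i

/-- The exponents whose monomial attains the maximum `P(x)`. -/
def attained (x : Fin 2 → ℝ) : Set (Fin 2 →₀ ℕ) :=
  {α | α ∈ P.support ∧ ∀ β ∈ P.support, P.term β x ≤ P.term α x}

/-- The exponents whose monomial gives the value of `P` on all of `S`. -/
def attainedOn (S : Set (Fin 2 → ℝ)) : Set (Fin 2 →₀ ℕ) :=
  {α | α ∈ P.support ∧ ∀ x ∈ S, α ∈ P.attained x}

/-- The corner locus of `P`. -/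
def cornerLocus : Set (Fin 2 → ℝ) :=
  {x | ∃ α β, α ≠ β ∧ α ∈ P.attained x ∧ β ∈ P.attained x}

/-- The (closed) edges of the corner locus, i.e. the cells of dimension one. -/
def edges : Set (Set (Fin 2 → ℝ)) :=
  {e | e.Nontrivial ∧ ∃ α ∈ P.support, ∃ β ∈ P.support, α ≠ β ∧
    e = {x | α ∈ P.attained x ∧ β ∈ P.attained x}}

open Classical in
/-- The weight of an edge: the maximum of `gcd (|i - k|, |j - l|)` over the pairs of exponents
`(i, j)`, `(k, l)` whose monomials give the value of `P` on the edge
(and `0` for a set that is not an edge). -/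
def weight (e : Set (Fin 2 → ℝ)) : ℕ :=
  if e ∈ P.edges then
    (P.support ×ˢ P.support).sup fun p =>
      if p.1 ∈ P.attainedOn e ∧ p.2 ∈ P.attainedOn e then
        Int.gcd ((p.1 0 : ℤ) - p.2 0) ((p.1 1 : ℤ) - p.2 1)
      else 0
  else 0

/-- The polygon `Δ(x)`, the cell of the dual subdivision that is dual to the cell containing
`x` in the decomposition of the plane induced by `P`. -/
def dualCell (x : Fin 2 → ℝ) : Set (Fin 2 → ℝ) :=
  convexHull ℝ ((fun (α : Fin 2 →₀ ℕ) (i : Fin 2) => (α i : ℝ)) '' P.attained x)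

/-- The curve of `P` is non-singular: every two-dimensional cell of the dual subdivision has
Euclidean area `1/2`, and all edges have weight one. (If the Newton polygon has dimension two,
the second condition follows from the first.) -/
def NonSingular : Prop :=
  (∀ x, MeasureTheory.volume (P.dualCell x) ≠ 0 → MeasureTheory.volume (P.dualCell x) = 1 / 2) ∧
    ∀ e ∈ P.edges, P.weight e = 1

end TropPoly

/-- A polyhedral complex of dimension one in the plane, with a weight function on its edges
(extended by `0` to the sets that are not edges). -/
@[ext] structure WeightedComplex where
  carrier : Set (Fin 2 → ℝ)
  edges : Set (Set (Fin 2 → ℝ))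
  weight : Set (Fin 2 → ℝ) → ℕ

/-- The tropical curve defined by a tropical polynomial. -/
def TropPoly.curve (P : TropPoly) : WeightedComplex where
  carrier := P.cornerLocus
  edges := P.edges
  weight := P.weight

/-- The tropical intersection multiplicity at `v` of the curves of `P` and `Q`. The cell dual to
`v` in the mixed subdivision of the union of the two curves is the Minkowski sum of the cells
dual to `v` for the two curves; a cell dual to a point that is not a vertex has area zero. -/
def tropMult (P Q : TropPoly) (v : Fin 2 → ℝ) : ℝ :=
  MeasureTheory.volume.real (P.dualCell v + Q.dualCell v) -
    (MeasureTheory.volume.real (P.dualCell v) + MeasureTheory.volume.real (Q.dualCell v))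

/-- `u` is an isolated point of the intersection of the curves of `P` and `Q`, and it lies in the
(relative) interior of the closed edge `e` of the first and of the closed edge `e'` of the second
curve. -/
def IsTransverseAt (P Q : TropPoly) (e e' : Set (Fin 2 → ℝ)) (u : Fin 2 → ℝ) : Prop :=
  (∃ U ∈ nhds u, U ∩ (P.cornerLocus ∩ Q.cornerLocus) = {u}) ∧
    e ∈ P.edges ∧ u ∈ intrinsicInterior ℝ e ∧ e' ∈ Q.edges ∧ u ∈ intrinsicInterior ℝ e'

/-! ### Real phase structures -/

/-- The sign at the copy `ε(v)` of the lattice point `v`, for a distribution of signs `δ` extended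
to the symmetric copies by `δ (ε(v)) = (-1) ^ (ε₁ v₁ + ε₂ v₂) δ (v)`. -/
def extendSign (δ : (Fin 2 →₀ ℕ) → ℤˣ) (ε : Fin 2 → ZMod 2) (v : Fin 2 →₀ ℕ) : ℤˣ :=
  (-1) ^ ((ε 0).val * v 0 + (ε 1).val * v 1) * δ v

/-- The set `𝓔_e` attached to the edge `e` by the distribution of signs `δ`: the symmetries `ε`
such that two vertices of the copy by `ε` of the dual edge of `e` have opposite signs, i.e.
such that the copy of `e` by `ε` lies in the real part of the curve. -/
def TropPoly.phase (P : TropPoly) (δ : (Fin 2 →₀ ℕ) → ℤˣ) (e : Set (Fin 2 → ℝ)) :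
    Set (Fin 2 → ZMod 2) :=
  {ε | ∃ α ∈ P.attainedOn e, ∃ β ∈ P.attainedOn e, extendSign δ ε α ≠ extendSign δ ε β}

/-- A non-singular real tropical curve `(C, 𝓔)`: a non-singular tropical curve with a real phase
structure, that is a family `𝓔_e` of sets of symmetries indexed by the edges `e` which is induced
by some distribution of signs. -/
structure RealTropicalCurve where
  poly : TropPoly
  nonSingular : poly.NonSingular
  phase : Set (Fin 2 → ℝ) → Set (Fin 2 → ZMod 2)
  phase_eq : ∃ δ : (Fin 2 →₀ ℕ) → ℤˣ, ∀ e ∈ poly.edges, phase e = poly.phase δ e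

/-! ### Curves in the torus over `𝕂` and their tropicalisation -/

/-- The set of zeros in the torus `(𝕂ˣ)²`. -/
def torusZeros (F : MvPolynomial (Fin 2) 𝕂) : Set (Fin 2 → 𝕂) :=
  {p | (∀ i, p i ≠ 0) ∧ MvPolynomial.eval p F = 0}

/-- The tropicalisation of a point of the torus. -/
def tropPoint (p : Fin 2 → 𝕂) : Fin 2 → ℝ := fun i => -𝕂.val (p i)

/-- The tropical polynomial of a polynomial over `𝕂`. -/
def tropPoly (F : MvPolynomial (Fin 2) 𝕂) : TropPoly where
  support := F.support
  coeff := fun α => -𝕂.val (F.coeff α)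

/-- The tropicalisation of the curve defined by `F`: the image of the curve under `tropPoint`,
with the weighted edges given by the tropical polynomial of `F`. -/
def tropicalisation (F : MvPolynomial (Fin 2) 𝕂) : WeightedComplex where
  carrier := tropPoint '' torusZeros F
  edges := (tropPoly F).edges
  weight := (tropPoly F).weight

/-- The set `Z` in the torus is a realisation of the non-singular real tropical curve `X`: it is
the curve defined by a polynomial with real coefficients, its tropicalisation is the
tropical curve underlying `X`, and the signs of the coefficients of the polynomial induce the
real phase structure of `X`. -/
def IsRealisation (X : RealTropicalCurve) (Z : Set (Fin 2 → 𝕂)) : Prop :=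
  ∃ F : MvPolynomial (Fin 2) 𝕂, (∀ α, (F.coeff α).IsReal) ∧ Z = torusZeros F ∧
    tropicalisation F = X.poly.curve ∧
    ∀ e ∈ X.poly.edges, X.phase e = (tropPoly F).phase (fun α => (F.coeff α).sign) e

/-- A point is real if its coordinates are real. -/
def IsRealPoint (p : Fin 2 → 𝕂) : Prop := ∀ i, (p i).IsReal

/-- The complex conjugate of a point. -/
def conjPoint (p : Fin 2 → 𝕂) : Fin 2 → 𝕂 := fun i => (p i).conj

/-- The finite set `S` consists of `r` real points and `k` pairs of complex conjugated
(non-real) points. -/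
def ConsistsOf (S : Set (Fin 2 → 𝕂)) (r k : ℕ) : Prop :=
  S.Finite ∧ (∀ p ∈ S, conjPoint p ∈ S) ∧ {p ∈ S | IsRealPoint p}.ncard = r ∧
    {T : Set (Fin 2 → 𝕂) | ∃ p ∈ S, ¬ IsRealPoint p ∧ T = {p, conjPoint p}}.ncard = k

end RealTropical

end

noncomputable section

namespace RealTropical

section

open Filter Topology

/-! ### The valuation ring of `𝕂` -/

/-! The points above `u` are found from their leading coefficients. Since an edge of a non-singular
curve has weight one, exactly two monomials of each defining polynomial `F`, `F'` attain the
tropical maximum at `u`, and their exponents differ by primitive vectors `v` and `w`. After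
substituting `tpow (-u i) * x i` for the coordinates and multiplying by a suitable power of `t`,
both polynomials have coefficients in the valuation ring, and their reductions are the binomials
formed by the two leading terms (`exists_scaled_polynomial`). Reducing modulo positive exponents, a
point above `u` gives a torus solution of `ξ^v = p`, `ξ^w = q`. At such a solution the Jacobian is,
up to nonzero factors, the determinant `n = v 0 * w 1 - v 1 * w 0`, whose absolute value is the
intersection multiplicity (`jacobian_binomials_ne_zero`, `tropMult_eq_abs_det`). Hence every
solution lifts uniquely by Hensel's lemma (`existsUnique_lift`), and taking leading coefficients is
a bijection (`bijOn_leadingCoeff`).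

Hensel's lemma must produce convergent series. One and the same iteration is therefore controlled
twice: by exponents, which makes it converge formally, and by the norm `absSum t`, uniformly for
small `t`, which makes the limit absolutely convergent.

Counting takes place over the complex numbers. As `v` is primitive, a monomial change of coordinates
turns the system into `ζ ^ n = q * p ^ (-k)`, with `|n|` solutions. One is real if `n` is odd. If
`n` is even, primitivity of `w` forces `k` to be odd, so there are two or no real solutions
according to the sign of `p * q`. Conjugation commutes with taking leading coefficients, so real
solutions correspond to real points.

Finally, the phase of an edge is a level set of the linear form defined by `v` (respectively `w`)
modulo 2, at a level given by the product of the two coefficient signs. If `n` is even, then `v` and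
`w` agree modulo 2, so the phases agree exactly when these products agree, that is, when `p * q` is
positive (`setOf_extendSign_ne_eq_iff`, `unitSign_mul_eq_iff`). -/

/-- The series with nonnegative exponents. -/
def valRing : Subring 𝕂 where
  carrier := {x | 0 ≤ x.1.orderTop}
  mul_mem' := fun {x y} hx hy => by
    refine le_trans ?_ (HahnSeries.orderTop_add_le_mul (x := x.1) (y := y.1))
    exact add_nonneg (α := WithTop ℝ) hx hy
  one_mem' := by
    change (0 : WithTop ℝ) ≤ HahnSeries.orderTop (1 : HahnSeries ℝ ℂ)
    rw [HahnSeries.orderTop_one]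
  add_mem' := fun {x y} hx hy =>
    le_trans (le_min hx hy) (HahnSeries.min_orderTop_le_orderTop_add (x := x.1) (y := y.1))
  zero_mem' := by
    change (0 : WithTop ℝ) ≤ HahnSeries.orderTop (0 : HahnSeries ℝ ℂ)
    rw [HahnSeries.orderTop_zero]; exact le_top
  neg_mem' := fun {x} hx => by
    change 0 ≤ HahnSeries.orderTop (-x.1)
    rw [HahnSeries.orderTop_neg]; exact hx

namespace valRing

/-- The Hahn series underlying an element of the valuation ring. -/
def series (x : valRing) : HahnSeries ℝ ℂ := x.1.1

theorem series_injective : Function.Injective series := fun _ _ h =>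
  Subtype.ext (Subtype.ext h)

@[simp] theorem series_add (x y : valRing) : series (x + y) = series x + series y := rfl
@[simp] theorem series_sub (x y : valRing) : series (x - y) = series x - series y := rfl
@[simp] theorem series_mul (x y : valRing) : series (x * y) = series x * series y := rfl
@[simp] theorem series_neg (x : valRing) : series (-x) = -series x := rfl
@[simp] theorem series_zero : series 0 = 0 := rfl
@[simp] theorem series_one : series 1 = 1 := rfl

theorem coeff_eq_zero_of_neg (x : valRing) {r : ℝ} (hr : r < 0) : (series x).coeff r = 0 :=
  HahnSeries.coeff_eq_zero_of_lt_orderTop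
    (lt_of_lt_of_le (by exact_mod_cast hr) (show 0 ≤ (series x).orderTop from x.2))

/-- The ideal of the series with exponents at least `c`. -/
def above (c : ℝ) : Ideal valRing where
  carrier := {x | (c : WithTop ℝ) ≤ (series x).orderTop}
  add_mem' := fun {x y} hx hy => le_trans (le_min hx hy)
    (HahnSeries.min_orderTop_le_orderTop_add (x := series x) (y := series y))
  zero_mem' := by
    change (c : WithTop ℝ) ≤ HahnSeries.orderTop (0 : HahnSeries ℝ ℂ)
    rw [HahnSeries.orderTop_zero]; exact le_top
  smul_mem' := fun x y hy => by
    refine le_trans ?_ (HahnSeries.orderTop_add_le_mul (x := series x) (y := series y))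
    have h1 : 0 ≤ (series x).orderTop := x.2
    calc (c : WithTop ℝ) = 0 + c := (zero_add _).symm
      _ ≤ _ := add_le_add h1 hy

theorem mem_above_iff {c : ℝ} {x : valRing} :
    x ∈ above c ↔ ∀ r < c, (series x).coeff r = 0 := by
  change (c : WithTop ℝ) ≤ (series x).orderTop ↔ _
  rw [HahnSeries.le_orderTop_iff_forall]
  simp

theorem above_mono {c d : ℝ} (h : c ≤ d) : above d ≤ above c := fun x hx => by
  rw [mem_above_iff] at *
  exact fun r hr => hx r (hr.trans_le h)

theorem above_mul_le (c d : ℝ) : above c * above d ≤ above (c + d) := by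
  rw [Ideal.mul_le]
  intro x hx y hy
  refine le_trans ?_ (HahnSeries.orderTop_add_le_mul (x := series x) (y := series y))
  rw [WithTop.coe_add]
  exact add_le_add hx hy

theorem eq_zero_of_forall_mem_above {x : valRing} (h : ∀ c : ℝ, x ∈ above c) : x = 0 := by
  apply series_injective
  ext r
  exact mem_above_iff.1 (h (r + 1)) r (by linarith)

/-- The residue map: the coefficient of exponent zero. -/
def res : valRing →+* ℂ where
  toFun x := (series x).coeff 0
  map_one' := by simp
  map_zero' := by simp
  map_add' := by simp
  map_mul' := fun x y => by
    classical
    rw [series_mul, HahnSeries.coeff_mul]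
    -- Both exponents are nonnegative, so they add up to zero only if both vanish.
    rw [Finset.sum_eq_single ((0 : ℝ), (0 : ℝ))]
    · intro p hp hne
      obtain ⟨h1, h2, h3⟩ := Finset.mem_antidiagonal.1 hp
      by_contra hcon
      have h1' : 0 ≤ p.1 := by
        by_contra hh
        exact h1 (coeff_eq_zero_of_neg x (not_le.1 hh))
      have h2' : 0 ≤ p.2 := by
        by_contra hh
        exact h2 (coeff_eq_zero_of_neg y (not_le.1 hh))
      exact hne (Prod.ext (by simp; linarith) (by simp; linarith))
    · intro hn
      rw [Finset.mem_antidiagonal] at hn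
      by_contra hcon
      exact hn ⟨left_ne_zero_of_mul hcon, right_ne_zero_of_mul hcon, by simp⟩

/-- The constant series. -/
def const : ℂ →+* valRing where
  toFun c := ⟨⟨HahnSeries.C c, locallyConvergent_single 0 c⟩, by
    change 0 ≤ (HahnSeries.single (0 : ℝ) c).orderTop
    exact HahnSeries.orderTop_single_le⟩
  map_one' := rfl
  map_zero' := by
    apply series_injective
    exact map_zero HahnSeries.C
  map_add' := fun a b => series_injective (map_add HahnSeries.C a b)
  map_mul' := fun a b => series_injective (map_mul HahnSeries.C a b)

@[simp] theorem res_const (c : ℂ) : res (const c) = c := by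
  change (HahnSeries.C c : HahnSeries ℝ ℂ).coeff 0 = c
  simp

theorem res_eq_zero_of_mem_above {x : valRing} {c : ℝ} (hc : 0 < c) (hx : x ∈ above c) :
    res x = 0 := mem_above_iff.1 hx 0 hc

/-- The value group is all of `ℝ`, so no uniformiser serves every series. Stating this as an
eventuality lets finitely many series share one positive exponent `γ`. -/
theorem eventually_mem_above {x : valRing} (hx : res x = 0) :
    ∀ᶠ c in 𝓝[>] (0 : ℝ), x ∈ above c := by
  rcases eq_or_ne (series x) 0 with h0 | h0
  · exact Eventually.of_forall fun c => mem_above_iff.2 (by simp [h0])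
  have hpos : 0 < (series x).order := by
    have h1 : 0 ≤ (series x).order := HahnSeries.zero_le_orderTop_iff.1 x.2
    refine lt_of_le_of_ne h1 fun h => ?_
    have h2 := mt HahnSeries.coeff_order_eq_zero.1 h0
    rw [← h] at h2
    exact h2 hx
  filter_upwards [Ioo_mem_nhdsGT hpos] with c hc
  rw [mem_above_iff]
  exact fun r hr => HahnSeries.coeff_eq_zero_of_lt_order (hr.trans hc.2)

/-! ### The norm of absolute convergence -/

/-- The sum of the absolute values of the terms of a series at `t`. -/
def absSum (t : ℝ) (x : valRing) : ENNReal :=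
  ∑' r : ℝ, ENNReal.ofReal (‖(series x).coeff r‖ * t ^ r)

theorem absSum_zero (t : ℝ) : absSum t 0 = 0 := by simp [absSum]

theorem absSum_add_le {t : ℝ} (ht : 0 < t) (x y : valRing) :
    absSum t (x + y) ≤ absSum t x + absSum t y := by
  unfold absSum
  rw [← ENNReal.tsum_add]
  refine ENNReal.tsum_le_tsum fun r => ?_
  rw [← ENNReal.ofReal_add (by positivity) (by positivity), ← add_mul]
  refine ENNReal.ofReal_le_ofReal (mul_le_mul_of_nonneg_right ?_ (by positivity))
  exact norm_add_le _ _

theorem absSum_neg (t : ℝ) (x : valRing) : absSum t (-x) = absSum t x := by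
  simp [absSum]

theorem absSum_sum_le {t : ℝ} (ht : 0 < t) {ι : Type*} (s : Finset ι) (x : ι → valRing) :
    absSum t (∑ i ∈ s, x i) ≤ ∑ i ∈ s, absSum t (x i) := by
  classical
  induction s using Finset.induction_on with
  | empty => simp [absSum_zero]
  | insert i s hi ih =>
    rw [Finset.sum_insert hi, Finset.sum_insert hi]
    exact (absSum_add_le ht _ _).trans (by gcongr)

theorem absSum_mul_le {t : ℝ} (ht : 0 < t) (x y : valRing) :
    absSum t (x * y) ≤ absSum t x * absSum t y := by
  conv_lhs => rw [absSum, ENNReal.tsum_eq_iSup_sum]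
  refine iSup_le fun F => ?_
  obtain ⟨A, B, -, -, h⟩ := mul_finite_bound (series x) (series y) ht F
  have hnn : ∀ (z : HahnSeries ℝ ℂ) (r : ℝ), 0 ≤ ‖z.coeff r‖ * t ^ r := fun z r => by positivity
  rw [← ENNReal.ofReal_sum_of_nonneg fun i _ => by positivity]
  refine (ENNReal.ofReal_le_ofReal h).trans ?_
  rw [ENNReal.ofReal_mul (Finset.sum_nonneg fun i _ => hnn _ i),
    ENNReal.ofReal_sum_of_nonneg fun i _ => hnn _ i,
    ENNReal.ofReal_sum_of_nonneg fun i _ => hnn _ i]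
  exact mul_le_mul' (ENNReal.sum_le_tsum A) (ENNReal.sum_le_tsum B)

theorem exists_absSum_lt_top (x : valRing) : ∃ t : ℝ, 0 < t ∧ absSum t x < ⊤ := by
  obtain ⟨t₀, ht₀, h⟩ := locallyConvergent_iff.1 x.1.2
  refine ⟨t₀ / 2, by positivity, ?_⟩
  have h1 : Summable fun r => ‖(series x).coeff r‖ * (t₀ / 2) ^ r :=
    h (t₀ / 2) (by positivity) (by linarith)
  unfold absSum
  rw [← ENNReal.ofReal_tsum_of_nonneg (fun r => by positivity) h1]
  exact ENNReal.ofReal_lt_top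

/-- Only exponents `r ≥ c` occur, and for these `s ^ r ≤ s ^ c`. This converts a lower bound on
exponents into smallness of the norm: with `c = 0` it gives boundedness, with `c > 0` convergence to
zero as `t` decreases. -/
theorem absSum_scale_le {s t c : ℝ} (hs : 0 < s) (hs1 : s ≤ 1) (ht : 0 < t) {x : valRing}
    (hx : x ∈ above c) : absSum (t * s) x ≤ ENNReal.ofReal (s ^ c) * absSum t x := by
  unfold absSum
  rw [← ENNReal.tsum_mul_left]
  refine ENNReal.tsum_le_tsum fun r => ?_
  rw [← ENNReal.ofReal_mul (by positivity)]
  refine ENNReal.ofReal_le_ofReal ?_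
  rcases lt_or_ge r c with h | h
  · rw [mem_above_iff.1 hx r h]; simp
  · rw [Real.mul_rpow ht.le hs.le]
    have := Real.rpow_le_rpow_of_exponent_ge hs hs1 h
    calc ‖(series x).coeff r‖ * (t ^ r * s ^ r) = s ^ r * (‖(series x).coeff r‖ * t ^ r) := by ring
      _ ≤ _ := mul_le_mul_of_nonneg_right this (by positivity)

theorem mem_above_zero (x : valRing) : x ∈ above 0 :=
  mem_above_iff.2 fun _ hr => coeff_eq_zero_of_neg x hr

theorem exists_eventually_absSum_le (x : valRing) :
    ∃ C : NNReal, ∀ᶠ t in 𝓝[>] (0 : ℝ), absSum t x ≤ C := by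
  obtain ⟨t₀, ht₀, h⟩ := exists_absSum_lt_top x
  refine ⟨(absSum t₀ x).toNNReal, ?_⟩
  filter_upwards [Ioo_mem_nhdsGT ht₀] with t ht
  rw [ENNReal.coe_toNNReal h.ne]
  have := absSum_scale_le (s := t / t₀) (div_pos ht.1 ht₀) ((div_le_one ht₀).2 ht.2.le) ht₀
    (mem_above_zero x)
  rwa [mul_div_cancel₀ _ ht₀.ne', Real.rpow_zero, ENNReal.ofReal_one, one_mul] at this

theorem eventually_absSum_le {x : valRing} (hx : res x = 0) {ε : ENNReal} (hε : 0 < ε) :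
    ∀ᶠ t in 𝓝[>] (0 : ℝ), absSum t x ≤ ε := by
  obtain ⟨t₀, ht₀, h⟩ := exists_absSum_lt_top x
  obtain ⟨c, hcx, hc⟩ := ((eventually_mem_above hx).and self_mem_nhdsWithin).exists
  have hlim : Tendsto (fun t : ℝ => ENNReal.ofReal ((t / t₀) ^ c) * absSum t₀ x) (𝓝[>] 0)
      (𝓝 (ENNReal.ofReal ((0 / t₀) ^ c) * absSum t₀ x)) := by
    refine ENNReal.Tendsto.mul_const ?_ (Or.inr h.ne)
    refine ENNReal.tendsto_ofReal (tendsto_nhdsWithin_of_tendsto_nhds ?_)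
    exact (Real.continuousAt_rpow_const _ _ (Or.inr hc.le)).tendsto.comp
      ((continuous_id.div_const t₀).tendsto 0)
  rw [zero_div, Real.zero_rpow (ne_of_gt hc), ENNReal.ofReal_zero, zero_mul] at hlim
  filter_upwards [Ioo_mem_nhdsGT ht₀, hlim.eventually_le_const hε] with t ht h2
  have := absSum_scale_le (s := t / t₀) (div_pos ht.1 ht₀) ((div_le_one ht₀).2 ht.2.le) ht₀ hcx
  rw [mul_div_cancel₀ _ ht₀.ne'] at this
  exact this.trans h2

end valRing

end

section

open Filter Topology MvPolynomial

/-! ### Taylor expansion to first order -/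

section Taylor

variable {R σ : Type*} [CommRing R]

theorem eval_sub_eval_mem {J : Ideal R} {x y : σ → R} (h : ∀ i, x i - y i ∈ J)
    (p : MvPolynomial σ R) : eval x p - eval y p ∈ J := by
  induction p using MvPolynomial.induction_on with
  | C a => simp
  | add p q hp hq =>
    rw [map_add, map_add, add_sub_add_comm]
    exact J.add_mem hp hq
  | mul_X p j hp =>
    rw [map_mul, map_mul, eval_X, eval_X]
    have : eval x p * x j - eval y p * y j
        = (eval x p - eval y p) * x j + eval y p * (x j - y j) := by ring
    rw [this]
    exact J.add_mem (J.mul_mem_right _ hp) (J.mul_mem_left _ (h j))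

variable [Fintype σ]

/-- The product rule for the first-order remainder. It is the induction step both for the estimate
by ideals and for the estimate by norms. The derivatives are frozen at `ξ` while `x` and `y` both
vary, as the contraction argument requires. -/
theorem eval_mul_X_sub_taylor (ξ x y : σ → R) (p : MvPolynomial σ R) (j : σ) :
    eval x (p * X j) - eval y (p * X j) - ∑ i, eval ξ (pderiv i (p * X j)) * (x i - y i) =
      (eval x p - eval y p - ∑ i, eval ξ (pderiv i p) * (x i - y i)) * ξ j +
        (eval x p - eval y p) * (x j - ξ j) + (eval y p - eval ξ p) * (x j - y j) := by
  classical
  have h : ∑ i, eval ξ (pderiv i (p * X j)) * (x i - y i) =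
      (∑ i, eval ξ (pderiv i p) * (x i - y i)) * ξ j + eval ξ p * (x j - y j) := by
    have h1 : ∀ i, eval ξ (pderiv i (p * X j)) * (x i - y i) =
        eval ξ (pderiv i p) * (x i - y i) * ξ j +
          (if j = i then eval ξ p * (x i - y i) else 0) := by
      intro i
      rw [pderiv_mul, pderiv_X]
      rcases eq_or_ne j i with rfl | hij
      · simp; ring
      · simp [hij]; ring
    rw [Finset.sum_congr rfl fun i _ => h1 i, Finset.sum_add_distrib, ← Finset.sum_mul,
      Finset.sum_ite_eq, if_pos (Finset.mem_univ j)]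
  rw [h, map_mul, map_mul, eval_X, eval_X]
  ring

theorem taylor_sub_mem {I J : Ideal R} {ξ x y : σ → R} (hx : ∀ i, x i - ξ i ∈ I)
    (hy : ∀ i, y i - ξ i ∈ I) (hxy : ∀ i, x i - y i ∈ J) (p : MvPolynomial σ R) :
    eval x p - eval y p - ∑ i, eval ξ (pderiv i p) * (x i - y i) ∈ I * J := by
  induction p using MvPolynomial.induction_on with
  | C a => simp
  | add p q hp hq =>
    have : eval x (p + q) - eval y (p + q) - ∑ i, eval ξ (pderiv i (p + q)) * (x i - y i) =
        (eval x p - eval y p - ∑ i, eval ξ (pderiv i p) * (x i - y i)) +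
        (eval x q - eval y q - ∑ i, eval ξ (pderiv i q) * (x i - y i)) := by
      simp only [map_add, add_mul, Finset.sum_add_distrib]
      ring
    rw [this]
    exact Ideal.add_mem _ hp hq
  | mul_X p j hp =>
    rw [eval_mul_X_sub_taylor]
    refine Ideal.add_mem _ (Ideal.add_mem _ (Ideal.mul_mem_right _ _ hp) ?_)
      (Ideal.mul_mem_mul (eval_sub_eval_mem hy p) (hxy j))
    rw [mul_comm (eval x p - eval y p)]
    exact Ideal.mul_mem_mul (hx j) (eval_sub_eval_mem hxy p)

end Taylor

namespace valRing

/-- The remainder is quadratic with a constant independent of `t`, `ρ` and `y`. This uniformity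
permits `ρ` to be fixed first and `t` to be made small afterwards. -/
theorem absSum_taylor_le {σ : Type*} [Fintype σ] (ξ : σ → valRing) (p : MvPolynomial σ valRing) :
    ∃ C : NNReal, ∀ᶠ t in 𝓝[>] (0 : ℝ), ∀ ρ : NNReal, ρ ≤ 1 → ∀ y : σ → valRing,
      (∀ i, absSum t (y i) ≤ ρ) →
      absSum t (eval (ξ + y) p - eval ξ p - ∑ i, eval ξ (pderiv i p) * y i) ≤ C * ρ ^ 2 := by
  induction p using MvPolynomial.induction_on with
  | C a => exact ⟨0, Eventually.of_forall fun t ρ _ y _ => by simp [absSum_zero]⟩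
  | add p q hp hq =>
    obtain ⟨C, hC⟩ := hp
    obtain ⟨D, hD⟩ := hq
    refine ⟨C + D, ?_⟩
    filter_upwards [hC, hD, self_mem_nhdsWithin] with t h1 h2 ht ρ hρ y hy
    have : eval (ξ + y) (p + q) - eval ξ (p + q) - ∑ i, eval ξ (pderiv i (p + q)) * y i =
        (eval (ξ + y) p - eval ξ p - ∑ i, eval ξ (pderiv i p) * y i) +
        (eval (ξ + y) q - eval ξ q - ∑ i, eval ξ (pderiv i q) * y i) := by
      simp only [map_add, add_mul, Finset.sum_add_distrib]
      ring
    rw [this, ENNReal.coe_add, add_mul]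
    exact (absSum_add_le ht _ _).trans (add_le_add (h1 ρ hρ y hy) (h2 ρ hρ y hy))
  | mul_X p j hp =>
    obtain ⟨C, hC⟩ := hp
    obtain ⟨B, hB⟩ := exists_eventually_absSum_le (ξ j)
    choose D hD using fun i => exists_eventually_absSum_le (eval ξ (pderiv i p))
    refine ⟨C * B + (C + ∑ i, D i), ?_⟩
    filter_upwards [hC, hB, eventually_all.2 hD, self_mem_nhdsWithin] with t h1 h2 h3 ht ρ hρ y hy
    have key := eval_mul_X_sub_taylor ξ (ξ + y) ξ p j
    simp only [Pi.add_apply, add_sub_cancel_left, sub_self, zero_mul, add_zero] at key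
    rw [key]
    set E := eval (ξ + y) p - eval ξ p - ∑ i, eval ξ (pderiv i p) * y i with hE
    have hE1 := h1 ρ hρ y hy
    rw [← hE] at hE1
    have h4 : eval (ξ + y) p - eval ξ p = E + ∑ i, eval ξ (pderiv i p) * y i := by rw [hE]; ring
    rw [h4]
    -- For `ρ ≤ 1` the quadratic remainder is absorbed into a linear bound on the increment of `p`,
    -- which the factor `y j` then makes quadratic again.
    have hρ' : (ρ : ENNReal) ^ 2 ≤ ρ := by
      rw [pow_two]
      exact mul_le_of_le_one_right' (by exact_mod_cast hρ)
    have h5 : absSum t (E + ∑ i, eval ξ (pderiv i p) * y i) ≤ (C + ∑ i, (D i : ENNReal)) * ρ := by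
      refine (absSum_add_le ht _ _).trans ?_
      rw [add_mul, Finset.sum_mul]
      refine add_le_add (hE1.trans (by gcongr)) ((absSum_sum_le ht _ _).trans ?_)
      exact Finset.sum_le_sum fun i _ => (absSum_mul_le ht _ _).trans (mul_le_mul' (h3 i) (hy i))
    calc absSum t (E * ξ j + (E + ∑ i, eval ξ (pderiv i p) * y i) * y j)
        ≤ (C * ρ ^ 2) * B + ((C + ∑ i, (D i : ENNReal)) * ρ) * ρ :=
          (absSum_add_le ht _ _).trans (add_le_add
            ((absSum_mul_le ht _ _).trans (mul_le_mul' hE1 h2))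
            ((absSum_mul_le ht _ _).trans (mul_le_mul' h5 (hy j))))
      _ = _ := by push_cast; ring

/-! ### Limits -/

theorem sub_mem_above_of_le {x : ℕ → valRing} {γ : ℝ} (hγ : 0 < γ)
    (h : ∀ n : ℕ, x (n + 1) - x n ∈ above (n * γ)) {n m : ℕ} (hnm : n ≤ m) :
    x m - x n ∈ above (n * γ) := by
  induction m, hnm using Nat.le_induction with
  | base => simp
  | succ m hm ih =>
    rw [← sub_add_sub_cancel (x (m + 1)) (x m) (x n)]
    refine Ideal.add_mem _ (above_mono ?_ (h m)) ih
    have : (n : ℝ) ≤ m := by exact_mod_cast hm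
    gcongr

/-- The coefficient of exponent `r` is constant once `n * γ > r`, which defines the limit. On any
finite set of exponents the limit coincides with some `x n`, so the uniform bound on the norms
passes to all its finite partial sums and gives absolute convergence. -/
theorem exists_limit {x : ℕ → valRing} {γ : ℝ} (hγ : 0 < γ)
    (h : ∀ n : ℕ, x (n + 1) - x n ∈ above (n * γ)) {C : NNReal}
    (hC : ∀ᶠ t in 𝓝[>] (0 : ℝ), ∀ n, absSum t (x n) ≤ C) :
    ∃ L : valRing, ∀ n : ℕ, L - x n ∈ above (n * γ) := by
  have hN : ∀ r : ℝ, ∃ n : ℕ, r < n * γ := fun r => by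
    obtain ⟨n, hn⟩ := exists_nat_gt (r / γ)
    exact ⟨n, (div_lt_iff₀ hγ).1 hn⟩
  choose N hN using hN
  have hstab : ∀ (r : ℝ) (n m : ℕ), r < n * γ → n ≤ m →
      (series (x m)).coeff r = (series (x n)).coeff r := by
    intro r n m hr hnm
    have := mem_above_iff.1 (sub_mem_above_of_le hγ h hnm) r hr
    rwa [series_sub, HahnSeries.coeff_sub, sub_eq_zero] at this
  set c : ℝ → ℂ := fun r => (series (x (N r))).coeff r with hc
  have hcn : ∀ (r : ℝ) (n : ℕ), r < n * γ → c r = (series (x n)).coeff r := by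
    intro r n hr
    change (series (x (N r))).coeff r = _
    rw [← hstab r n (max n (N r)) hr (le_max_left _ _),
      ← hstab r (N r) (max n (N r)) (hN r) (le_max_right _ _)]
  have hwf : (Function.support c).IsPWO := by
    rw [Set.isPWO_iff_isWF]
    refine Set.WellFoundedOn.mono' (r' := fun a b => a < b) (fun _ _ _ _ h => h) ?_
    rw [Set.wellFoundedOn_iff_no_descending_seq]
    rintro f hf
    -- A descending sequence in the support stays below its first term, hence lies in the support of
    -- the single approximant `x (N (f 0))`, which is well-ordered.
    have hlt : ∀ k, f k ≤ f 0 := fun k => by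
      rcases Nat.eq_zero_or_pos k with rfl | hk
      · exact le_rfl
      · exact (f.map_rel_iff.2 hk : f k < f 0).le
    have hw := (series (x (N (f 0)))).isWF_support
    unfold Set.IsWF at hw
    rw [Set.wellFoundedOn_iff_no_descending_seq] at hw
    refine hw f fun k => ?_
    have h1 := hf k
    rw [Function.mem_support, hcn (f k) (N (f 0)) ((hlt k).trans_lt (hN _))] at h1
    exact h1
  let s : HahnSeries ℝ ℂ := ⟨c, hwf⟩
  have hs : LocallyConvergent s := by
    rw [locallyConvergent_iff]
    obtain ⟨t₀, ht₀, hlt⟩ := mem_nhdsGT_iff_exists_Ioo_subset.1 hC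
    refine ⟨t₀, ht₀, fun t ht htt => ?_⟩
    have hCt : ∀ n, absSum t (x n) ≤ C := hlt ⟨ht, htt⟩
    refine summable_of_sum_le (c := C) (fun r => by positivity) fun F => ?_
    obtain ⟨n, hn⟩ : ∃ n, ∀ r ∈ F, N r ≤ n := ⟨F.sup N, fun r hr => Finset.le_sup hr⟩
    have h1 : ∑ r ∈ F, ‖s.coeff r‖ * t ^ r = ∑ r ∈ F, ‖(series (x n)).coeff r‖ * t ^ r := by
      refine Finset.sum_congr rfl fun r hr => ?_
      rw [hstab r (N r) n (hN r) (hn r hr)]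
    have h2 : ENNReal.ofReal (∑ r ∈ F, ‖(series (x n)).coeff r‖ * t ^ r) ≤ C := by
      rw [ENNReal.ofReal_sum_of_nonneg fun i _ => by positivity]
      exact (ENNReal.sum_le_tsum F).trans (hCt n)
    rw [h1]
    rw [ENNReal.ofReal_le_iff_le_toReal ENNReal.coe_ne_top] at h2
    simpa using h2
  have hs0 : 0 ≤ s.orderTop := by
    rw [HahnSeries.le_orderTop_iff_forall]
    intro r hr
    exact coeff_eq_zero_of_neg _ (by exact_mod_cast hr)
  refine ⟨⟨⟨s, hs⟩, hs0⟩, fun n => mem_above_iff.2 fun r hr => ?_⟩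
  change c r - (series (x n)).coeff r = 0
  rw [hcn r n hr, sub_self]

end valRing

end

section

open Filter Topology MvPolynomial

namespace valRing

/-! ### Hensel's lemma in two variables -/

/-- The contraction estimate: each application of `H` gains `γ`, because the linear term carries a
derivative in `above γ` and the Taylor remainder a factor from `x - ξ` or `y - ξ`. -/
theorem eval_sub_eval_mem_above {H : MvPolynomial (Fin 2) valRing} {ξ x y : Fin 2 → valRing}
    {γ D : ℝ} (hH : ∀ j, eval ξ (pderiv j H) ∈ above γ) (hx : ∀ i, x i - ξ i ∈ above γ)
    (hy : ∀ i, y i - ξ i ∈ above γ) (hxy : ∀ i, x i - y i ∈ above D) :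
    eval x H - eval y H ∈ above (γ + D) := by
  refine above_mul_le γ D ?_
  have h := taylor_sub_mem hx hy hxy H
  have h2 : ∑ i, eval ξ (pderiv i H) * (x i - y i) ∈ above γ * above D :=
    Ideal.sum_mem _ fun i _ => Ideal.mul_mem_mul (hH i) (hxy i)
  simpa using Ideal.add_mem _ h h2

section FixedPoint

variable {H : Fin 2 → MvPolynomial (Fin 2) valRing} {ξ : Fin 2 → valRing}

theorem eq_of_fixedPoint (h1 : ∀ i j, res (eval ξ (pderiv j (H i))) = 0) {x y : Fin 2 → valRing}
    (hx : ∀ i, res (x i) = res (ξ i)) (hxH : ∀ i, eval x (H i) = x i)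
    (hy : ∀ i, res (y i) = res (ξ i)) (hyH : ∀ i, eval y (H i) = y i) : x = y := by
  have e1 := eventually_all.2 fun i => eventually_all.2 fun j => eventually_mem_above (h1 i j)
  have e2 := eventually_all.2 fun i => eventually_mem_above (x := x i - ξ i) (by simp [hx])
  have e3 := eventually_all.2 fun i => eventually_mem_above (x := y i - ξ i) (by simp [hy])
  obtain ⟨γ, ⟨⟨g1, g2⟩, g3⟩, hγ⟩ :=
    (((e1.and e2).and e3).and (self_mem_nhdsWithin (s := Set.Ioi (0 : ℝ)))).exists
  have hγ : 0 < γ := hγ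
  have key : ∀ n : ℕ, ∀ i, x i - y i ∈ above (n * γ) := by
    intro n
    induction n with
    | zero => intro i; simpa using mem_above_zero _
    | succ n ih =>
      intro i
      have := eval_sub_eval_mem_above (g1 i) g2 g3 ih
      rw [hxH, hyH] at this
      convert this using 2
      push_cast; ring
  funext i
  refine sub_eq_zero.1 (eq_zero_of_forall_mem_above fun c => ?_)
  obtain ⟨n, hn⟩ := exists_nat_gt (c / γ)
  exact above_mono ((div_lt_iff₀ hγ).1 hn).le (key n i)

/-- Picard iteration from `ξ`. The exponent estimate makes successive differences lie in `above (n *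
γ)`; the norm estimate keeps all iterates within distance `ρ` of `ξ` for every small `t`. Together
they are the hypotheses of `exists_limit`. -/
theorem exists_fixedPoint (h0 : ∀ i, res (eval ξ (H i)) = res (ξ i))
    (h1 : ∀ i j, res (eval ξ (pderiv j (H i))) = 0) :
    ∃ x : Fin 2 → valRing, (∀ i, res (x i) = res (ξ i)) ∧ ∀ i, eval x (H i) = x i := by
  have hd : ∀ i, res (eval ξ (H i) - ξ i) = 0 := fun i => by rw [map_sub, h0, sub_self]
  have e1 := eventually_all.2 fun i => eventually_all.2 fun j => eventually_mem_above (h1 i j)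
  have e2 := eventually_all.2 fun i => eventually_mem_above (hd i)
  obtain ⟨γ, ⟨g1, g2⟩, hγ⟩ :=
    ((e1.and e2).and (self_mem_nhdsWithin (s := Set.Ioi (0 : ℝ)))).exists
  have hγ : 0 < γ := hγ
  let x : ℕ → Fin 2 → valRing := fun n => Nat.rec ξ (fun _ y i => eval y (H i)) n
  have hx0 : x 0 = ξ := rfl
  have hxs : ∀ n i, x (n + 1) i = eval (x n) (H i) := fun n i => rfl
  have hxξ : ∀ n i, x n i - ξ i ∈ above γ := by
    intro n
    induction n with
    | zero => intro i; simp [hx0]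
    | succ n ih =>
      intro i
      rw [hxs, ← sub_add_sub_cancel _ (eval ξ (H i))]
      refine Ideal.add_mem _ ?_ (g2 i)
      exact above_mono (by linarith)
        (eval_sub_eval_mem_above (g1 i) ih (fun i => by simp) ih)
  have hstep : ∀ (n : ℕ) i, x (n + 1) i - x n i ∈ above (n * γ) := by
    intro n
    induction n with
    | zero => intro i; simpa using mem_above_zero _
    | succ n ih =>
      intro i
      rw [hxs (n + 1), hxs n]
      refine above_mono ?_ (eval_sub_eval_mem_above (g1 i) (hxξ (n + 1)) (hxξ n) ih)
      push_cast; linarith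
  choose C hC using fun i => absSum_taylor_le ξ (H i)
  choose B hB using fun i => exists_eventually_absSum_le (ξ i)
  -- This radius makes the quadratic remainder `C i * ρ ^ 2` at most `ρ / 4`. The initial defect
  -- will be at most `ρ / 4` and each of the two linear terms at most `ρ / 8`, so the ball of radius
  -- `ρ` is preserved.
  let ρ : NNReal := 1 / (4 * (C 0 + C 1 + 1))
  have hρ0 : 0 < ρ := by positivity
  have hρC : ∀ i, C i * ρ ≤ 1 / 4 := by
    intro i
    have : C i ≤ C 0 + C 1 + 1 := by
      rw [add_assoc]
      fin_cases i
      · exact le_self_add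
      · exact le_add_of_nonneg_of_le zero_le (le_self_add)
    calc C i * ρ ≤ (C 0 + C 1 + 1) * (1 / (4 * (C 0 + C 1 + 1))) := by gcongr
      _ = 1 / 4 := by field_simp
  have hρ1 : ρ ≤ 1 := by
    refine div_le_one_of_le₀ ?_ zero_le
    calc (1 : NNReal) ≤ 4 * 1 := by norm_num
      _ ≤ _ := by gcongr; exact le_add_self
  have f1 := eventually_all.2 fun i => eventually_all.2 fun j =>
    eventually_absSum_le (h1 i j) (ε := ((1 / 8 : NNReal) : ENNReal)) (by norm_num)
  have f2 := eventually_all.2 fun i =>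
    eventually_absSum_le (hd i) (ε := ((ρ / 4 : NNReal) : ENNReal))
      (by exact_mod_cast (by positivity : 0 < ρ / 4))
  have hbound : ∀ᶠ t in 𝓝[>] (0 : ℝ), ∀ n i, absSum t (x n i - ξ i) ≤ ρ := by
    filter_upwards [f1, f2, eventually_all.2 hC, self_mem_nhdsWithin] with t b1 b2 b3 ht n
    induction n with
    | zero => intro i; simp [hx0, absSum_zero]
    | succ n ih =>
      intro i
      set y : Fin 2 → valRing := fun i => x n i - ξ i with hy
      have hxy : x n = ξ + y := by funext i; simp [hy]
      have hsplit : x (n + 1) i - ξ i = (eval ξ (H i) - ξ i) +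
          (∑ j, eval ξ (pderiv j (H i)) * y j + (eval (ξ + y) (H i) - eval ξ (H i) -
            ∑ j, eval ξ (pderiv j (H i)) * y j)) := by
        rw [hxs, hxy]; ring
      rw [hsplit]
      have hsum : absSum t (∑ j, eval ξ (pderiv j (H i)) * y j) ≤
          ∑ j : Fin 2, ((1 / 8 : NNReal) : ENNReal) * ρ :=
        (absSum_sum_le ht _ _).trans (Finset.sum_le_sum fun j _ =>
          (absSum_mul_le ht _ _).trans (mul_le_mul' (b1 i j) (ih j)))
      refine (absSum_add_le ht _ _).trans ((add_le_add (b2 i) ((absSum_add_le ht _ _).trans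
        (add_le_add hsum (b3 i ρ hρ1 y ih)))).trans ?_)
      have hreal : ρ / 4 + ((1 / 8 * ρ + 1 / 8 * ρ) + C i * ρ ^ 2) ≤ ρ := by
        have h6 : C i * ρ ^ 2 ≤ 1 / 4 * ρ := by
          rw [pow_two, ← mul_assoc]
          exact mul_le_mul_left (hρC i) ρ
        have h7 : (C i : ℝ) * (ρ : ℝ) ^ 2 ≤ 1 / 4 * ρ := by exact_mod_cast h6
        have h8 : (0 : ℝ) < ρ := by exact_mod_cast hρ0
        have h9 : (ρ : ℝ) / 4 + ((1 / 8 * ρ + 1 / 8 * ρ) + C i * (ρ : ℝ) ^ 2) ≤ ρ := by linarith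
        exact_mod_cast h9
      rw [Fin.sum_univ_two]
      exact_mod_cast hreal
  have hlim : ∀ i, ∃ L : valRing, ∀ n : ℕ, L - x n i ∈ above (n * γ) := by
    intro i
    refine exists_limit hγ (fun n => hstep n i) (C := B i + ρ) ?_
    filter_upwards [hbound, hB i, self_mem_nhdsWithin] with t b1 b2 ht n
    have : x n i = ξ i + (x n i - ξ i) := by ring
    rw [this, ENNReal.coe_add]
    exact (absSum_add_le ht _ _).trans (add_le_add b2 (b1 n i))
  choose Lim hLim using hlim
  have hLξ : ∀ i, Lim i - ξ i ∈ above γ := fun i => by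
    rw [← sub_add_sub_cancel _ (x 1 i)]
    exact Ideal.add_mem _ (by simpa using hLim i 1) (hxξ 1 i)
  refine ⟨Lim, fun i => ?_, fun i => ?_⟩
  · have := res_eq_zero_of_mem_above hγ (hLξ i)
    rwa [map_sub, sub_eq_zero] at this
  · refine sub_eq_zero.1 (eq_zero_of_forall_mem_above fun c => ?_)
    obtain ⟨n, hn⟩ := exists_nat_gt (c / γ)
    refine above_mono ((div_lt_iff₀ hγ).1 hn).le ?_
    rw [← sub_add_sub_cancel _ (x (n + 1) i)]
    refine Ideal.add_mem _ ?_ ?_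
    · rw [hxs]
      exact above_mono (by linarith)
        (eval_sub_eval_mem_above (g1 i) hLξ (hxξ n) fun i => hLim i n)
    · rw [← neg_sub]
      refine neg_mem (above_mono ?_ (hLim i (n + 1)))
      push_cast; linarith

end FixedPoint

theorem res_eval (x : Fin 2 → valRing) (p : MvPolynomial (Fin 2) valRing) :
    res (eval x p) = eval (fun i => res (x i)) (map res p) := by
  exact MvPolynomial.map_eval res x p

/-- Hensel's lemma for two equations in two variables. -/
theorem existsUnique_lift (F : Fin 2 → MvPolynomial (Fin 2) valRing) (a : Fin 2 → ℂ)
    (h0 : ∀ i, eval a (map res (F i)) = 0)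
    (hdet : (Matrix.of fun i j => eval a (pderiv j (map res (F i)))).det ≠ 0) :
    ∃! x : Fin 2 → valRing, (∀ i, res (x i) = a i) ∧ ∀ i, eval x (F i) = 0 := by
  classical
  set J : Matrix (Fin 2) (Fin 2) ℂ := Matrix.of fun i j => eval a (pderiv j (map res (F i)))
    with hJ
  have hinv : J⁻¹ * J = 1 := Matrix.nonsing_inv_mul _ (isUnit_iff_ne_zero.2 hdet)
  have hinv' : J * J⁻¹ = 1 := Matrix.mul_nonsing_inv _ (isUnit_iff_ne_zero.2 hdet)
  let ξ : Fin 2 → valRing := fun i => const (a i)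
  have hξ : (fun i => res (ξ i)) = a := funext fun i => res_const (a i)
  -- Newton's map with the inverse Jacobian frozen at the residue point. Its fixed points are the
  -- common zeros of `F` because `J` is invertible, and its derivative reduces to `1 - J⁻¹ * J = 0`.
  let H : Fin 2 → MvPolynomial (Fin 2) valRing := fun i =>
    X i - ∑ k, C (const (J⁻¹ i k)) * F k
  have hH : ∀ x i, eval x (H i) = x i - ∑ k, const (J⁻¹ i k) * eval x (F k) := by
    intro x i
    simp [H]
  have hHfix : ∀ x, (∀ i, eval x (H i) = x i) ↔ ∀ i, eval x (F i) = 0 := by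
    intro x
    constructor
    · intro h
      have h2 : (J⁻¹.map const).mulVec (fun k => eval x (F k)) = 0 := by
        funext i
        have := h i
        rw [hH, sub_eq_self] at this
        simpa [Matrix.mulVec, dotProduct] using this
      have h3 : (J.map const).mulVec ((J⁻¹.map const).mulVec (fun k => eval x (F k))) = 0 := by
        rw [h2, Matrix.mulVec_zero]
      rw [Matrix.mulVec_mulVec, ← Matrix.map_mul, hinv', Matrix.map_one _ (map_zero _) (map_one _),
        Matrix.one_mulVec] at h3
      exact fun i => congrFun h3 i
    · intro h i
      rw [hH]
      simp [h]
  have hres0 : ∀ i, res (eval ξ (H i)) = res (ξ i) := by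
    intro i
    rw [hH, map_sub, map_sum, sub_eq_self]
    refine Finset.sum_eq_zero fun k _ => ?_
    rw [map_mul, res_eval, hξ, h0, mul_zero]
  have hres1 : ∀ i j, res (eval ξ (pderiv j (H i))) = 0 := by
    intro i j
    have h1 : (J⁻¹ * J) i j = (1 : Matrix _ _ ℂ) i j := by rw [hinv]
    rw [Matrix.mul_apply, Matrix.one_apply] at h1
    have h2 : res (eval ξ (pderiv j (H i))) =
        (if i = j then 1 else 0) - ∑ k, J⁻¹ i k * J k j := by
      simp only [H, map_sub, map_sum, pderiv_C_mul, pderiv_X, map_mul, eval_C]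
      congr 1
      · by_cases hij : i = j
        · subst hij; simp
        · simp [hij]
      · refine Finset.sum_congr rfl fun k _ => ?_
        rw [res_const, res_eval, hξ, ← pderiv_map]
        rfl
    rw [h2, h1, sub_self]
  obtain ⟨x, hx, hxH⟩ := exists_fixedPoint hres0 hres1
  refine ⟨x, ⟨fun i => by rw [hx]; exact res_const _, (hHfix x).1 hxH⟩, ?_⟩
  rintro y ⟨hy, hyF⟩
  exact eq_of_fixedPoint hres1 (fun i => by rw [hy]; exact (res_const _).symm)
    ((hHfix y).2 hyF) hx hxH

end valRing

end

section

open Filter Topology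

/-! ### Primitive lattice vectors -/

theorem exists_eq_mul_of_det_eq_zero {v₀ v₁ w₀ w₁ : ℤ} (hv : Int.gcd v₀ v₁ = 1)
    (h : v₀ * w₁ = v₁ * w₀) : ∃ k : ℤ, w₀ = k * v₀ ∧ w₁ = k * v₁ := by
  obtain ⟨s, r, hsr⟩ := Int.isCoprime_iff_gcd_eq_one.2 hv
  refine ⟨s * w₀ + r * w₁, ?_, ?_⟩
  · linear_combination (-w₀) * hsr - r * h
  · linear_combination (-w₁) * hsr + s * h

/-! ### Edges of weight one -/

/-- The line through `x` and `u` stays in the affine span of `e`, so it can be followed a little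
beyond `u` without leaving `e`. -/
theorem exists_reflection_mem_of_mem_intrinsicInterior {e : Set (Fin 2 → ℝ)} {u x : Fin 2 → ℝ}
    (hu : u ∈ intrinsicInterior ℝ e) (hx : x ∈ e) :
    ∃ s : ℝ, 0 < s ∧ (fun i => u i - s * (x i - u i)) ∈ e := by
  obtain ⟨y, hy, rfl⟩ := mem_intrinsicInterior.1 hu
  let x' : affineSpan ℝ e := ⟨x, subset_affineSpan ℝ e hx⟩
  let f : ℝ → affineSpan ℝ e := fun s =>
    ⟨AffineMap.lineMap (y : Fin 2 → ℝ) x (-s), AffineMap.lineMap_mem _ y.2 x'.2⟩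
  have hf : Continuous f := by
    refine Continuous.subtype_mk ?_ _
    exact AffineMap.lineMap_continuous.comp continuous_neg
  have hf0 : f 0 = y := Subtype.ext (by simp [f])
  have hnhds : ((↑) ⁻¹' e : Set (affineSpan ℝ e)) ∈ 𝓝 (f 0) := by
    rw [hf0]
    exact mem_interior_iff_mem_nhds.1 hy
  have hmem : ∀ᶠ s in 𝓝 (0 : ℝ), (f s : Fin 2 → ℝ) ∈ e :=
    hf.continuousAt.preimage_mem_nhds hnhds
  obtain ⟨s, hs, hspos⟩ :=
    ((hmem.filter_mono (nhdsWithin_le_nhds (s := Set.Ioi 0))).and self_mem_nhdsWithin).exists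
  refine ⟨s, hspos, ?_⟩
  have h1 : AffineMap.lineMap (y : Fin 2 → ℝ) x (-s) ∈ e := hs
  convert h1 using 1
  funext i
  simp [AffineMap.lineMap_apply]
  ring

namespace TropPoly

variable {P Q : TropPoly} {e : Set (Fin 2 → ℝ)} {u : Fin 2 → ℝ} {α β : Fin 2 →₀ ℕ}

theorem term_eq_of_mem_attained {x : Fin 2 → ℝ} (hα : α ∈ P.attained x) (hβ : β ∈ P.attained x) :
    P.term α x = P.term β x :=
  le_antisymm (hβ.2 α hα.1) (hα.2 β hβ.1)

/-- On `e` the monomial `γ` minus a maximal one is an affine function that is nowhere positive and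
vanishes at `u`. Were it negative at `x`, it would be positive at a point of `e` on the other side
of `u`. -/
theorem mem_attainedOn_of_mem_attained (he : e ∈ P.edges) (hu : u ∈ intrinsicInterior ℝ e)
    {γ : Fin 2 →₀ ℕ} (hγ : γ ∈ P.attained u) : γ ∈ P.attainedOn e := by
  obtain ⟨-, α, hα, β, -, -, rfl⟩ := he
  refine ⟨hγ.1, fun x hx => ⟨hγ.1, fun δ hδ => ?_⟩⟩
  obtain ⟨s, hs, hy⟩ := exists_reflection_mem_of_mem_intrinsicInterior hu hx
  have h1 := term_eq_of_mem_attained (intrinsicInterior_subset hu).1 hγ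
  have h2 := hy.1.2 γ hγ.1
  refine (hx.1.2 δ hδ).trans ?_
  simp only [term, Fin.sum_univ_two] at h1 h2 ⊢
  have h3 : s * (P.coeff α + (α 0 * x 0 + α 1 * x 1)) ≤ s * (P.coeff γ + (γ 0 * x 0 + γ 1 * x 1)) := by
    nlinarith
  exact le_of_mul_le_mul_left h3 hs

/-- The exponents `α` and `β` are the endpoints of the edge, of lattice length one, of the dual
subdivision that is dual to the edge `e`, and `u` is a point in the interior of `e`. -/
structure IsDualPair (P : TropPoly) (e : Set (Fin 2 → ℝ)) (u : Fin 2 → ℝ) (α β : Fin 2 →₀ ℕ) :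
    Prop where
  attained_eq : P.attained u = {α, β}
  attainedOn_eq : P.attainedOn e = {α, β}
  gcd_eq_one : Int.gcd ((α 0 : ℤ) - β 0) ((α 1 : ℤ) - β 1) = 1

/-- Both exponent differences are orthogonal to the direction of `e`. Two tropical polynomials are
allowed because the one of a realisation need not be the chosen one, although they share their
edges. -/
theorem det_eq_zero_of_mem_attainedOn (he : e.Nontrivial) {γ δ : Fin 2 →₀ ℕ}
    (hα : α ∈ P.attainedOn e) (hβ : β ∈ P.attainedOn e) (hγ : γ ∈ Q.attainedOn e)
    (hδ : δ ∈ Q.attainedOn e) :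
    ((α 0 : ℤ) - β 0) * ((γ 1 : ℤ) - δ 1) = ((α 1 : ℤ) - β 1) * ((γ 0 : ℤ) - δ 0) := by
  obtain ⟨x, hx, y, hy, hxy⟩ := he
  have h1 := term_eq_of_mem_attained (hα.2 x hx) (hβ.2 x hx)
  have h2 := term_eq_of_mem_attained (hα.2 y hy) (hβ.2 y hy)
  have h3 := term_eq_of_mem_attained (hγ.2 x hx) (hδ.2 x hx)
  have h4 := term_eq_of_mem_attained (hγ.2 y hy) (hδ.2 y hy)
  simp only [term, Fin.sum_univ_two] at h1 h2 h3 h4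
  have e1 : ((α 0 : ℝ) - β 0) * (x 0 - y 0) + ((α 1 : ℝ) - β 1) * (x 1 - y 1) = 0 := by
    linear_combination h1 - h2
  have e2 : ((γ 0 : ℝ) - δ 0) * (x 0 - y 0) + ((γ 1 : ℝ) - δ 1) * (x 1 - y 1) = 0 := by
    linear_combination h3 - h4
  set a := ((α 0 : ℝ) - β 0)
  set b := ((α 1 : ℝ) - β 1)
  set c := ((γ 0 : ℝ) - δ 0)
  set d := ((γ 1 : ℝ) - δ 1)
  have key : a * d = b * c := by
    by_cases h0 : x 0 - y 0 = 0
    · have h1' : x 1 - y 1 ≠ 0 := by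
        intro h1'
        apply hxy
        funext i
        fin_cases i
        · exact sub_eq_zero.1 h0
        · exact sub_eq_zero.1 h1'
      have : (a * d - b * c) * (x 1 - y 1) = 0 := by linear_combination a * e2 - c * e1
      exact sub_eq_zero.1 ((mul_eq_zero.1 this).resolve_right h1')
    · have : (a * d - b * c) * (x 0 - y 0) = 0 := by linear_combination d * e1 - b * e2
      exact sub_eq_zero.1 ((mul_eq_zero.1 this).resolve_right h0)
  have key' : (((((α 0 : ℤ) - β 0) * ((γ 1 : ℤ) - δ 1) : ℤ)) : ℝ) =
      ((((α 1 : ℤ) - β 1) * ((γ 0 : ℤ) - δ 0) : ℤ) : ℝ) := by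
    push_cast
    exact key
  exact Int.cast_injective key'

/-- Weight one makes `α - β` primitive, so any other exponent attained on `e` is `β + k * (α - β)`
for an integer `k`. Its lattice distances `|k|` to `β` and `|k - 1|` to `α` are at most one, whence
`k` is 0 or 1. -/
theorem exists_isDualPair (he : e ∈ P.edges) (hw : P.weight e = 1)
    (hu : u ∈ intrinsicInterior ℝ e) : ∃ α β, P.IsDualPair e u α β := by
  classical
  have hgcd : ∀ γ ∈ P.attainedOn e, ∀ δ ∈ P.attainedOn e,
      Int.gcd ((γ 0 : ℤ) - δ 0) ((γ 1 : ℤ) - δ 1) ≤ 1 := by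
    intro γ hγ δ hδ
    refine le_of_le_of_eq ?_ hw
    rw [weight, if_pos he]
    have hmem : (γ, δ) ∈ P.support ×ˢ P.support := Finset.mem_product.2 ⟨hγ.1, hδ.1⟩
    refine le_trans ?_ (Finset.le_sup hmem)
    rw [if_pos ⟨hγ, hδ⟩]
  obtain ⟨hnt, α, hα, β, hβ, hαβ, hee⟩ := id he
  have hα' : α ∈ P.attainedOn e := ⟨hα, fun x hx => by rw [hee] at hx; exact hx.1⟩
  have hβ' : β ∈ P.attainedOn e := ⟨hβ, fun x hx => by rw [hee] at hx; exact hx.2⟩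
  have hone : Int.gcd ((α 0 : ℤ) - β 0) ((α 1 : ℤ) - β 1) = 1 := by
    refine le_antisymm (hgcd α hα' β hβ') (Nat.one_le_iff_ne_zero.2 fun h => hαβ ?_)
    rw [Int.gcd_eq_zero_iff] at h
    ext i
    fin_cases i
    · exact_mod_cast sub_eq_zero.1 h.1
    · exact_mod_cast sub_eq_zero.1 h.2
  have hon : P.attainedOn e = {α, β} := by
    refine Set.Subset.antisymm (fun γ hγ => ?_) ?_
    · obtain ⟨k, hk0, hk1⟩ := exists_eq_mul_of_det_eq_zero hone
        (det_eq_zero_of_mem_attainedOn hnt hα' hβ' hγ hβ')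
      have g1 := hgcd γ hγ β hβ'
      have g2 := hgcd γ hγ α hα'
      have hk0' : (γ 0 : ℤ) - α 0 = (k - 1) * ((α 0 : ℤ) - β 0) := by linear_combination hk0
      have hk1' : (γ 1 : ℤ) - α 1 = (k - 1) * ((α 1 : ℤ) - β 1) := by linear_combination hk1
      rw [hk0, hk1, Int.gcd_mul_left, hone, mul_one] at g1
      rw [hk0', hk1', Int.gcd_mul_left, hone, mul_one] at g2
      have hk : k = 0 ∨ k = 1 := by omega
      rcases hk with rfl | rfl
      · right
        rw [zero_mul] at hk0 hk1
        ext i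
        fin_cases i
        · exact_mod_cast sub_eq_zero.1 hk0
        · exact_mod_cast sub_eq_zero.1 hk1
      · left
        rw [sub_self, zero_mul] at hk0' hk1'
        ext i
        fin_cases i
        · exact_mod_cast sub_eq_zero.1 hk0'
        · exact_mod_cast sub_eq_zero.1 hk1'
    · rintro γ (rfl | rfl)
      · exact hα'
      · exact hβ'
  refine ⟨α, β, ?_, hon, hone⟩
  refine Set.Subset.antisymm (fun γ hγ => ?_) ?_
  · rw [← hon]
    exact mem_attainedOn_of_mem_attained he hu hγ
  · have hue := intrinsicInterior_subset hu
    rintro γ (rfl | rfl)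
    · exact hα'.2 u hue
    · exact hβ'.2 u hue

theorem IsDualPair.eq_or_eq_neg {γ δ : Fin 2 →₀ ℕ} (he : e.Nontrivial)
    (h : P.IsDualPair e u α β) (h' : Q.IsDualPair e u γ δ) :
    ∃ k : ℤ, (k = 1 ∨ k = -1) ∧ (γ 0 : ℤ) - δ 0 = k * ((α 0 : ℤ) - β 0) ∧
      (γ 1 : ℤ) - δ 1 = k * ((α 1 : ℤ) - β 1) := by
  obtain ⟨k, hk0, hk1⟩ := exists_eq_mul_of_det_eq_zero h.gcd_eq_one
    (det_eq_zero_of_mem_attainedOn (P := P) (Q := Q) (γ := γ) (δ := δ) he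
      (by rw [h.attainedOn_eq]; simp) (by rw [h.attainedOn_eq]; simp)
      (by rw [h'.attainedOn_eq]; simp) (by rw [h'.attainedOn_eq]; simp))
  refine ⟨k, ?_, hk0, hk1⟩
  have := h'.gcd_eq_one
  rw [hk0, hk1, Int.gcd_mul_left, h.gcd_eq_one, mul_one] at this
  omega

end TropPoly

/-! ### Areas of parallelograms -/

theorem volume_real_segment_add_segment (a b c d : Fin 2 → ℝ) :
    MeasureTheory.volume.real (segment ℝ a b + segment ℝ c d) =
      |(b 0 - a 0) * (d 1 - c 1) - (b 1 - a 1) * (d 0 - c 0)| := by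
  have h1 : segment ℝ a b + segment ℝ c d = (a + c) +ᵥ parallelepiped ![b - a, d - c] := by
    rw [parallelepiped_eq_sum_segment, Fin.sum_univ_two]
    have e1 : segment ℝ a b = {a} + segment ℝ 0 (b - a) := by
      rw [Set.singleton_add, segment_translate_image]
      simp
    have e2 : segment ℝ c d = {c} + segment ℝ 0 (d - c) := by
      rw [Set.singleton_add, segment_translate_image]
      simp
    rw [e1, e2, add_add_add_comm, Set.singleton_add_singleton, Set.singleton_add]
    rfl
  rw [h1, MeasureTheory.measureReal_def, MeasureTheory.measure_vadd]
  have h2 : (MeasureTheory.volume : MeasureTheory.Measure (Fin 2 → ℝ)) =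
      (Pi.basisFun ℝ (Fin 2)).addHaar := by
    rw [← MeasureTheory.addHaarMeasure_eq_volume_pi, ← Module.Basis.parallelepiped_basisFun,
      ← Module.Basis.addHaar_def]
  rw [h2, MeasureTheory.Measure.addHaar_parallelepiped, ENNReal.toReal_ofReal (abs_nonneg _),
    Pi.basisFun_det_apply, Matrix.det_fin_two]
  simp

theorem TropPoly.dualCell_eq_segment {P : TropPoly} {u : Fin 2 → ℝ} {α β : Fin 2 →₀ ℕ}
    (h : P.attained u = {α, β}) :
    P.dualCell u = segment ℝ (fun i => (α i : ℝ)) (fun i => (β i : ℝ)) := by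
  rw [dualCell, h, Set.image_pair, convexHull_pair]

theorem tropMult_eq_abs_det {P Q : TropPoly} {u : Fin 2 → ℝ} {α β γ δ : Fin 2 →₀ ℕ}
    (h : P.attained u = {α, β}) (h' : Q.attained u = {γ, δ}) :
    tropMult P Q u = ((|((α 0 : ℤ) - β 0) * ((γ 1 : ℤ) - δ 1) -
      ((α 1 : ℤ) - β 1) * ((γ 0 : ℤ) - δ 0)| : ℤ) : ℝ) := by
  -- A segment is a parallelogram whose second side is degenerate.
  have hseg : ∀ a b : Fin 2 → ℝ, MeasureTheory.volume.real (segment ℝ a b) = 0 := by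
    intro a b
    have := volume_real_segment_add_segment a b 0 0
    rw [segment_same] at this
    simpa using this
  rw [tropMult, TropPoly.dualCell_eq_segment h, TropPoly.dualCell_eq_segment h', hseg, hseg,
    volume_real_segment_add_segment]
  push_cast
  rw [add_zero, sub_zero]
  congr 1
  ring

end

/-! ### Roots of binomial equations -/

theorem ncard_setOf_pow_eq {m : ℕ} (hm : m ≠ 0) {D : ℂ} (hD : D ≠ 0) :
    {ζ : ℂ | ζ ^ m = D}.ncard = m := by
  classical
  obtain ⟨z, hz⟩ := IsAlgClosed.exists_pow_nat_eq D (Nat.pos_of_ne_zero hm)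
  have hz0 : z ≠ 0 := by
    rintro rfl
    rw [zero_pow hm] at hz
    exact hD hz.symm
  have h1 : {ζ : ℂ | ζ ^ m = D} =
      (fun x => z * x) '' ((Polynomial.nthRootsFinset m (1 : ℂ) : Finset ℂ) : Set ℂ) := by
    ext ζ
    simp only [Set.mem_ofPred_eq, Set.mem_image, Finset.mem_coe,
      Polynomial.mem_nthRootsFinset (Nat.pos_of_ne_zero hm)]
    constructor
    · intro h
      refine ⟨ζ / z, ?_, mul_div_cancel₀ _ hz0⟩
      rw [div_pow, h, hz, div_self hD]
    · rintro ⟨x, hx, rfl⟩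
      rw [mul_pow, hx, hz, mul_one]
  rw [h1, Set.ncard_image_of_injective _ (mul_right_injective₀ hz0), Set.ncard_coe_finset,
    (Complex.isPrimitiveRoot_exp m hm).card_nthRootsFinset]

theorem ncard_setOf_zpow_eq {n : ℤ} (hn : n ≠ 0) {D : ℂ} (hD : D ≠ 0) :
    {ζ : ℂ | ζ ^ n = D}.ncard = n.natAbs := by
  rcases Int.natAbs_eq n with h | h
  · have : {ζ : ℂ | ζ ^ n = D} = {ζ : ℂ | ζ ^ n.natAbs = D} := by
      ext ζ
      simp only [Set.mem_ofPred_eq]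
      conv_lhs => rw [h, zpow_natCast]
    rw [this, ncard_setOf_pow_eq (Int.natAbs_ne_zero.2 hn) hD]
  · have : {ζ : ℂ | ζ ^ n = D} = {ζ : ℂ | ζ ^ n.natAbs = D⁻¹} := by
      ext ζ
      simp only [Set.mem_ofPred_eq]
      conv_lhs => rw [h, zpow_neg, zpow_natCast, inv_eq_iff_eq_inv]
    rw [this, ncard_setOf_pow_eq (Int.natAbs_ne_zero.2 hn) (inv_ne_zero hD)]

/-- Taking absolute values leaves only the candidates `ρ` and `-ρ` with `ρ = |D| ^ (1 / n)`; parity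
of `n` and the sign of `D` decide which of them are solutions. A negative `n` needs no separate
treatment. -/
theorem ncard_setOf_zpow_eq_real {n : ℤ} (hn : n ≠ 0) {D : ℝ} (hD : D ≠ 0) :
    {ζ : ℂ | ζ ^ n = (D : ℂ) ∧ ζ.im = 0}.ncard =
      if Odd n then 1 else if 0 < D then 2 else 0 := by
  have hn' : (n : ℝ) ≠ 0 := by exact_mod_cast hn
  obtain ⟨ρ, hρ⟩ : ∃ ρ, ρ = |D| ^ (1 / (n : ℝ)) := ⟨_, rfl⟩
  have hDpos : 0 < |D| := abs_pos.2 hD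
  have hρpos : 0 < ρ := by rw [hρ]; positivity
  have hρn : ρ ^ n = |D| := by
    rw [hρ, ← Real.rpow_intCast, ← Real.rpow_mul hDpos.le, one_div_mul_cancel hn', Real.rpow_one]
  have h1 : {ζ : ℂ | ζ ^ n = (D : ℂ) ∧ ζ.im = 0} =
      (fun x : ℝ => (x : ℂ)) '' {x : ℝ | x ^ n = D} := by
    ext ζ
    simp only [Set.mem_ofPred_eq, Set.mem_image]
    constructor
    · rintro ⟨h, him⟩
      have hζ : ((ζ.re : ℝ) : ℂ) = ζ := Complex.ext rfl (by simp [him])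
      refine ⟨ζ.re, ?_, hζ⟩
      rw [← hζ] at h
      exact_mod_cast h
    · rintro ⟨x, hx, rfl⟩
      refine ⟨?_, by simp⟩
      rw [← hx]; push_cast; rfl
  have hsub : ∀ x : ℝ, x ^ n = D → x = ρ ∨ x = -ρ := by
    intro x hx
    have h2 : |x| ^ n = ρ ^ n := by rw [← abs_zpow, hx, hρn]
    rw [zpow_left_inj₀ (abs_nonneg _) hρpos.le hn] at h2
    exact (abs_eq hρpos.le).1 h2
  rw [h1, Set.ncard_image_of_injective _ Complex.ofReal_injective]
  have hne : ρ ≠ -ρ := by linarith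
  split_ifs with hodd hpos
  · have hneg : (-ρ) ^ n = -|D| := by rw [hodd.neg_zpow, hρn]
    rw [Set.ncard_eq_one]
    rcases lt_or_gt_of_ne hD with h | h
    · refine ⟨-ρ, Set.ext fun x => ⟨fun hx => ?_, ?_⟩⟩
      · rcases hsub x hx with rfl | rfl
        · rw [Set.mem_ofPred_eq, hρn] at hx; linarith
        · rfl
      · rintro rfl
        rw [Set.mem_ofPred_eq, hneg, abs_of_neg h, neg_neg]
    · refine ⟨ρ, Set.ext fun x => ⟨fun hx => ?_, ?_⟩⟩
      · rcases hsub x hx with rfl | rfl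
        · rfl
        · rw [Set.mem_ofPred_eq, hneg] at hx; linarith
      · rintro rfl
        rw [Set.mem_ofPred_eq, hρn, abs_of_pos h]
  · have heven : Even n := Int.not_odd_iff_even.1 hodd
    have : {x : ℝ | x ^ n = D} = {ρ, -ρ} := by
      refine Set.ext fun x => ⟨fun hx => hsub x hx, ?_⟩
      rintro (rfl | rfl)
      · rw [Set.mem_ofPred_eq, hρn, abs_of_pos hpos]
      · rw [Set.mem_ofPred_eq, heven.neg_zpow, hρn, abs_of_pos hpos]
    rw [this, Set.ncard_pair hne]
  · have heven : Even n := Int.not_odd_iff_even.1 hodd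
    have : {x : ℝ | x ^ n = D} = ∅ := by
      refine Set.eq_empty_of_forall_notMem fun x hx => hpos ?_
      have h0 : 0 ≤ x ^ n := heven.zpow_nonneg x
      rw [Set.mem_ofPred_eq] at hx
      exact lt_of_le_of_ne (hx ▸ h0) hD.symm
    rw [this, Set.ncard_empty]

/-- The solutions in the torus of a pair of binomial equations. -/
def binomialSolutions (v w : Fin 2 → ℤ) (p q : ℂ) : Set (Fin 2 → ℂ) :=
  {ξ | (∀ i, ξ i ≠ 0) ∧ ξ 0 ^ v 0 * ξ 1 ^ v 1 = p ∧ ξ 0 ^ w 0 * ξ 1 ^ w 1 = q}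

/-- The vectors `v` and `(-r, s)` form a basis of the lattice, so `ξ^v` and `ζ = ξ^(-r, s)` are
coordinates of the torus. With `k = s * w 0 + r * w 1` and `n` the determinant, `w = k * v + n *
(-r, s)`; thus after `ξ^v = p` the second equation reads `p ^ k * ζ ^ n = q`. -/
theorem bijOn_binomialSolutions {v w : Fin 2 → ℤ} {p q : ℂ} (hp : p ≠ 0) (hq : q ≠ 0)
    (hn : v 0 * w 1 - v 1 * w 0 ≠ 0) {s r : ℤ} (hsr : s * v 0 + r * v 1 = 1) :
    Set.BijOn (fun ξ : Fin 2 → ℂ => ξ 0 ^ (-r) * ξ 1 ^ s) (binomialSolutions v w p q)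
      {ζ | ζ ^ (v 0 * w 1 - v 1 * w 0) = q * p ^ (-(s * w 0 + r * w 1))} := by
  have inv : ∀ ξ ∈ binomialSolutions v w p q,
      p ^ s * (ξ 0 ^ (-r) * ξ 1 ^ s) ^ (-v 1) = ξ 0 ∧
      p ^ r * (ξ 0 ^ (-r) * ξ 1 ^ s) ^ (v 0) = ξ 1 := by
    rintro ξ ⟨h0, rfl, -⟩
    have h00 := h0 0
    have h01 := h0 1
    simp only [mul_zpow, ← zpow_mul]
    constructor
    · calc ξ 0 ^ (v 0 * s) * ξ 1 ^ (v 1 * s) * (ξ 0 ^ (-r * -v 1) * ξ 1 ^ (s * -v 1))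
          = ξ 0 ^ (v 0 * s + -r * -v 1) * ξ 1 ^ (v 1 * s + s * -v 1) := by
            rw [zpow_add₀ h00, zpow_add₀ h01]; ring
        _ = ξ 0 := by
            rw [show v 0 * s + -r * -v 1 = 1 by linarith, show v 1 * s + s * -v 1 = 0 by ring]
            simp
    · calc ξ 0 ^ (v 0 * r) * ξ 1 ^ (v 1 * r) * (ξ 0 ^ (-r * v 0) * ξ 1 ^ (s * v 0))
          = ξ 0 ^ (v 0 * r + -r * v 0) * ξ 1 ^ (v 1 * r + s * v 0) := by
            rw [zpow_add₀ h00, zpow_add₀ h01]; ring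
        _ = ξ 1 := by
            rw [show v 1 * r + s * v 0 = 1 by linarith, show v 0 * r + -r * v 0 = 0 by ring]
            simp
  refine ⟨?_, ?_, ?_⟩
  · rintro ξ ⟨h0, rfl, rfl⟩
    have h00 := h0 0
    have h01 := h0 1
    simp only [Set.mem_ofPred_eq, mul_zpow, ← zpow_mul]
    calc ξ 0 ^ (-r * (v 0 * w 1 - v 1 * w 0)) * ξ 1 ^ (s * (v 0 * w 1 - v 1 * w 0))
        = ξ 0 ^ (w 0 + v 0 * -(s * w 0 + r * w 1)) *
          ξ 1 ^ (w 1 + v 1 * -(s * w 0 + r * w 1)) := by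
          congr 2
          · linear_combination (w 0) * hsr
          · linear_combination (w 1) * hsr
      _ = _ := by
          rw [zpow_add₀ h00, zpow_add₀ h01]; ring
  · intro ξ hξ η hη h
    obtain ⟨a0, a1⟩ := inv ξ hξ
    obtain ⟨b0, b1⟩ := inv η hη
    simp only at h
    rw [h] at a0 a1
    funext i
    fin_cases i
    · exact a0.symm.trans b0
    · exact a1.symm.trans b1
  · intro ζ hζ
    simp only [Set.mem_ofPred_eq] at hζ
    have hζ0 : ζ ≠ 0 := by
      rintro rfl
      rw [zero_zpow _ hn] at hζ
      exact mul_ne_zero hq (zpow_ne_zero _ hp) hζ.symm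
    refine ⟨![p ^ s * ζ ^ (-v 1), p ^ r * ζ ^ v 0], ⟨?_, ?_, ?_⟩, ?_⟩
    · intro i
      fin_cases i
      · exact mul_ne_zero (zpow_ne_zero _ hp) (zpow_ne_zero _ hζ0)
      · exact mul_ne_zero (zpow_ne_zero _ hp) (zpow_ne_zero _ hζ0)
    · simp only [Matrix.cons_val_zero, Matrix.cons_val_one, mul_zpow, ← zpow_mul]
      calc p ^ (s * v 0) * ζ ^ (-v 1 * v 0) * (p ^ (r * v 1) * ζ ^ (v 0 * v 1))
          = p ^ (s * v 0 + r * v 1) * ζ ^ (-v 1 * v 0 + v 0 * v 1) := by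
            rw [zpow_add₀ hp, zpow_add₀ hζ0]; ring
        _ = p := by
            rw [hsr, show -v 1 * v 0 + v 0 * v 1 = 0 by ring]; simp
    · simp only [Matrix.cons_val_zero, Matrix.cons_val_one, mul_zpow, ← zpow_mul]
      calc p ^ (s * w 0) * ζ ^ (-v 1 * w 0) * (p ^ (r * w 1) * ζ ^ (v 0 * w 1))
          = p ^ (s * w 0 + r * w 1) * ζ ^ (v 0 * w 1 - v 1 * w 0) := by
            rw [show v 0 * w 1 - v 1 * w 0 = -v 1 * w 0 + v 0 * w 1 by ring,
              zpow_add₀ hp, zpow_add₀ hζ0]; ring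
        _ = q := by
            rw [hζ, mul_comm q, ← mul_assoc, ← zpow_add₀ hp, add_neg_cancel]; simp
    · simp only [Matrix.cons_val_zero, Matrix.cons_val_one, mul_zpow, ← zpow_mul]
      calc p ^ (s * -r) * ζ ^ (-v 1 * -r) * (p ^ (r * s) * ζ ^ (v 0 * s))
          = p ^ (s * -r + r * s) * ζ ^ (-v 1 * -r + v 0 * s) := by
            rw [zpow_add₀ hp, zpow_add₀ hζ0]; ring
        _ = ζ := by
            rw [show s * -r + r * s = 0 by ring, show -v 1 * -r + v 0 * s = 1 by linarith]; simp

theorem ncard_binomialSolutions {v w : Fin 2 → ℤ} {p q : ℂ} (hp : p ≠ 0) (hq : q ≠ 0)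
    (hv : Int.gcd (v 0) (v 1) = 1) (hn : v 0 * w 1 - v 1 * w 0 ≠ 0) :
    (binomialSolutions v w p q).ncard = (v 0 * w 1 - v 1 * w 0).natAbs := by
  obtain ⟨s, r, hsr⟩ := Int.isCoprime_iff_gcd_eq_one.2 hv
  have hbij := bijOn_binomialSolutions hp hq hn hsr
  rw [← ncard_setOf_zpow_eq hn (mul_ne_zero hq (zpow_ne_zero (-(s * w 0 + r * w 1)) hp)),
    ← hbij.image_eq, hbij.injOn.ncard_image]

theorem zpow_im_eq_zero {z : ℂ} (hz : z.im = 0) (n : ℤ) : (z ^ n).im = 0 := by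
  have h : ((z.re : ℝ) : ℂ) = z := Complex.ext rfl (by simp [hz])
  rw [← h, ← Complex.ofReal_zpow, Complex.ofReal_im]

theorem mul_im_eq_zero {y z : ℂ} (hy : y.im = 0) (hz : z.im = 0) : (y * z).im = 0 := by
  simp [hy, hz]

theorem ncard_binomialSolutions_real {v w : Fin 2 → ℤ} {p q : ℝ} (hp : p ≠ 0) (hq : q ≠ 0)
    (hv : Int.gcd (v 0) (v 1) = 1) (hw : Int.gcd (w 0) (w 1) = 1)
    (hn : v 0 * w 1 - v 1 * w 0 ≠ 0) :
    {ξ ∈ binomialSolutions v w p q | ∀ i, (ξ i).im = 0}.ncard =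
      if Odd (v 0 * w 1 - v 1 * w 0) then 1 else if 0 < p * q then 2 else 0 := by
  obtain ⟨s, r, hsr⟩ := Int.isCoprime_iff_gcd_eq_one.2 hv
  have hp' : (p : ℂ) ≠ 0 := by exact_mod_cast hp
  have hq' : (q : ℂ) ≠ 0 := by exact_mod_cast hq
  have hbij := bijOn_binomialSolutions hp' hq' hn hsr
  set k : ℤ := s * w 0 + r * w 1 with hk
  set n : ℤ := v 0 * w 1 - v 1 * w 0 with hndef
  have himg : (fun ξ : Fin 2 → ℂ => ξ 0 ^ (-r) * ξ 1 ^ s) ''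
      {ξ ∈ binomialSolutions v w p q | ∀ i, (ξ i).im = 0} =
      {ζ | ζ ^ n = ((q * p ^ (-k) : ℝ) : ℂ) ∧ ζ.im = 0} := by
    ext ζ
    constructor
    · rintro ⟨ξ, ⟨hξ, him⟩, rfl⟩
      refine ⟨?_, mul_im_eq_zero (zpow_im_eq_zero (him 0) _) (zpow_im_eq_zero (him 1) _)⟩
      have := hbij.mapsTo hξ
      push_cast
      exact this
    · rintro ⟨hζ, him⟩
      push_cast at hζ
      obtain ⟨ξ, hξ, hξζ⟩ := hbij.surjOn hζ
      have hconj : (fun i => (starRingEnd ℂ) (ξ i)) ∈ binomialSolutions v w p q := by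
        obtain ⟨h0, h1, h2⟩ := hξ
        refine ⟨fun i => by simpa using h0 i, ?_, ?_⟩
        · rw [← map_zpow₀, ← map_zpow₀, ← map_mul, h1, Complex.conj_ofReal]
        · rw [← map_zpow₀, ← map_zpow₀, ← map_mul, h2, Complex.conj_ofReal]
      -- As `p` and `q` are real, the conjugate of a solution is a solution; if `ζ` is real, both
      -- have the same image and injectivity makes them equal.
      have heq : (fun i => (starRingEnd ℂ) (ξ i)) = ξ := by
        refine hbij.injOn hconj hξ ?_
        rw [← map_zpow₀, ← map_zpow₀, ← map_mul]
        simp only at hξζ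
        rw [hξζ]
        exact Complex.conj_eq_iff_im.2 him
      exact ⟨ξ, ⟨hξ, fun i => Complex.conj_eq_iff_im.1 (congrFun heq i)⟩, hξζ⟩
  rw [← (hbij.injOn.mono (Set.sep_subset _ _)).ncard_image, himg,
    ncard_setOf_zpow_eq_real hn (mul_ne_zero hq (zpow_ne_zero _ hp))]
  by_cases hodd : Odd n
  · rw [if_pos hodd, if_pos hodd]
  rw [if_neg hodd, if_neg hodd]
  -- If `k` and `n` were both even, `w = k * v + n * (-r, s)` would be divisible by 2, contrary to
  -- primitivity. Oddness of `k` gives `q * p ^ (-k)` the sign of `p * q`.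
  have hkodd : Odd k := by
    by_contra hkeven
    obtain ⟨k', hk'⟩ := even_iff_two_dvd.1 (Int.not_odd_iff_even.1 hkeven)
    obtain ⟨n', hn'⟩ := even_iff_two_dvd.1 (Int.not_odd_iff_even.1 hodd)
    have h0 : (2 : ℤ) ∣ w 0 := ⟨k' * v 0 - n' * r, by
      linear_combination (-w 0) * hsr + v 0 * hk' - v 0 * hk - r * hn' + r * hndef⟩
    have h1 : (2 : ℤ) ∣ w 1 := ⟨k' * v 1 + n' * s, by
      linear_combination (-w 1) * hsr + v 1 * hk' - v 1 * hk + s * hn' - s * hndef⟩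
    have := Int.dvd_coe_gcd h0 h1
    rw [hw] at this
    norm_num at this
  have hiff : 0 < q * p ^ (-k) ↔ 0 < p * q := by
    have hodd' : Odd (-k) := hkodd.neg
    rcases lt_or_gt_of_ne hp with h | h
    · have h1 : p ^ (-k) < 0 := hodd'.zpow_neg_iff.2 h
      rw [mul_comm q, mul_pos_iff, mul_pos_iff]
      constructor <;> rintro (⟨h2, h3⟩ | ⟨h2, h3⟩)
      · linarith
      · exact Or.inr ⟨h, h3⟩
      · linarith
      · exact Or.inr ⟨h1, h3⟩
    · have h1 : 0 < p ^ (-k) := zpow_pos h _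
      rw [mul_comm q, mul_pos_iff_of_pos_left h1, mul_pos_iff_of_pos_left h]
  simp only [hiff]

/-! ### Free involutions -/

/-- The map `p ↦ {p, c p}` on `S` has the orbits as its fibres, and each has two elements. -/
theorem ncard_pairs_mul_two {X : Type*} {c : X → X} (hc : Function.Involutive c) {S : Set X}
    (hS : S.Finite) (hcS : ∀ p ∈ S, c p ∈ S) (hfree : ∀ p ∈ S, c p ≠ p) :
    {T : Set X | ∃ p ∈ S, T = {p, c p}}.ncard * 2 = S.ncard := by
  classical
  obtain ⟨s, rfl⟩ := hS.exists_finset_coe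
  have h1 : {T : Set X | ∃ p ∈ (s : Set X), T = {p, c p}} =
      ((s.image fun p => ({p, c p} : Set X)) : Set (Set X)) := by
    ext T
    simp [eq_comm]
  rw [h1, Set.ncard_coe_finset, Set.ncard_coe_finset,
    Finset.card_eq_sum_card_image (fun p => ({p, c p} : Set X)) s]
  rw [Finset.sum_const_nat (m := 2)]
  intro T hT
  obtain ⟨p, hp, rfl⟩ := Finset.mem_image.1 hT
  have : (s.filter fun a => ({a, c a} : Set X) = {p, c p}) = {p, c p} := by
    ext a
    simp only [Finset.mem_filter, Finset.mem_insert, Finset.mem_singleton]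
    constructor
    · rintro ⟨-, h⟩
      have : a ∈ ({p, c p} : Set X) := h ▸ Set.mem_insert _ _
      simpa using this
    · rintro (rfl | rfl)
      · exact ⟨hp, rfl⟩
      · exact ⟨hcS p hp, by rw [hc p, Set.pair_comm]⟩
  rw [this, Finset.card_pair (hfree p hp).symm]

section

open MvPolynomial

/-! ### Conjugation and monomials in `𝕂` -/

namespace 𝕂

theorem ext_coeff {x y : 𝕂} (h : ∀ r, x.1.coeff r = y.1.coeff r) : x = y :=
  Subtype.ext (HahnSeries.ext (funext h))

theorem coeff_conj (x : 𝕂) (r : ℝ) : x.conj.1.coeff r = (starRingEnd ℂ) (x.1.coeff r) := rfl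

/-- Complex conjugation as a ring homomorphism. -/
def conjHom : 𝕂 →+* 𝕂 where
  toFun := conj
  map_one' := ext_coeff fun r => by
    rw [coeff_conj]
    change (starRingEnd ℂ) ((1 : HahnSeries ℝ ℂ).coeff r) = (1 : HahnSeries ℝ ℂ).coeff r
    rw [HahnSeries.coeff_one]
    split_ifs <;> simp
  map_zero' := ext_coeff fun r => by simp [coeff_conj]
  map_add' := fun x y => ext_coeff fun r => by simp [coeff_conj]
  map_mul' := fun x y => Subtype.ext
    (HahnSeries.map_mul ((starRingEnd ℂ : ℂ →+* ℂ) : ℂ →ₙ+* ℂ) (x := x.1) (y := y.1))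

theorem conj_conj (x : 𝕂) : x.conj.conj = x := ext_coeff fun r => by simp [coeff_conj]

theorem isReal_iff_conj_eq {x : 𝕂} : x.IsReal ↔ x.conj = x := by
  constructor
  · intro h
    exact ext_coeff fun r => by rw [coeff_conj]; exact Complex.conj_eq_iff_im.2 (h r)
  · intro h r
    rw [← Complex.conj_eq_iff_im, ← coeff_conj, h]

/-- The power `t ^ r`. -/
def tpow (r : ℝ) : 𝕂 := ⟨HahnSeries.single r 1, locallyConvergent_single r 1⟩

theorem tpow_add (r s : ℝ) : tpow (r + s) = tpow r * tpow s :=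
  Subtype.ext (by simp [tpow])

theorem tpow_zero : tpow 0 = 1 := rfl

theorem tpow_pow (r : ℝ) (n : ℕ) : tpow r ^ n = tpow (n * r) := by
  induction n with
  | zero => simp [tpow_zero]
  | succ n ih =>
    rw [pow_succ, ih, ← tpow_add]
    congr 1
    push_cast; ring

theorem tpow_ne_zero (r : ℝ) : tpow r ≠ 0 := fun h => by
  have h1 := congrArg Subtype.val h
  exact HahnSeries.single_ne_zero one_ne_zero h1

theorem coeff_tpow_mul (r s : ℝ) (x : 𝕂) : (tpow r * x).1.coeff s = x.1.coeff (s - r) := by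
  change (HahnSeries.single r (1 : ℂ) * x.1).coeff s = _
  rw [HahnSeries.coeff_single_mul, one_mul]

theorem order_eq_of_coeff {x : HahnSeries ℝ ℂ} {c : ℝ} (h : x.coeff c ≠ 0)
    (h' : ∀ r < c, x.coeff r = 0) : x.order = c := by
  refine le_antisymm (HahnSeries.order_le_of_coeff_ne_zero h) ?_
  by_contra hlt
  have hx : x ≠ 0 := by rintro rfl; exact h rfl
  exact mt HahnSeries.coeff_order_eq_zero.1 hx (h' _ (not_le.1 hlt))

end 𝕂

open 𝕂 valRing

theorem val_tpow_mul {c : ℝ} {x : valRing} (hx : res x ≠ 0) :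
    𝕂.val (tpow c * x) = c ∧ (tpow c * (x : 𝕂)).1.leadingCoeff = res x ∧ tpow c * (x : 𝕂) ≠ 0 := by
  have h1 : (tpow c * (x : 𝕂)).1.coeff c = res x := by
    rw [coeff_tpow_mul, sub_self]; rfl
  have h2 : (tpow c * (x : 𝕂)).1.order = c := by
    refine order_eq_of_coeff (by rwa [h1]) fun r hr => ?_
    rw [coeff_tpow_mul]
    exact coeff_eq_zero_of_neg x (by linarith)
  refine ⟨h2, ?_, ?_⟩
  · rw [HahnSeries.leadingCoeff_eq, h2, h1]
  · intro h
    rw [h] at h1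
    exact hx h1.symm

theorem exists_eq_tpow_mul {y : 𝕂} (hy : y ≠ 0) :
    ∃ x : valRing, res x ≠ 0 ∧ y = tpow (𝕂.val y) * x := by
  have hy' : y.1 ≠ 0 := fun h => hy (Subtype.ext h)
  have hcoeff : ∀ s, (tpow (-𝕂.val y) * y).1.coeff s = y.1.coeff (s + y.1.order) := fun s => by
    rw [coeff_tpow_mul, sub_neg_eq_add]; rfl
  refine ⟨⟨tpow (-𝕂.val y) * y, ?_⟩, ?_, ?_⟩
  · change 0 ≤ HahnSeries.orderTop (tpow (-𝕂.val y) * y).1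
    rw [HahnSeries.le_orderTop_iff_forall]
    intro r hr
    have hr' : r < 0 := by exact_mod_cast hr
    rw [hcoeff]
    exact HahnSeries.coeff_eq_zero_of_lt_order (by linarith)
  · change (tpow (-𝕂.val y) * y).1.coeff 0 ≠ 0
    rw [hcoeff, zero_add]
    exact mt HahnSeries.coeff_order_eq_zero.1 hy'
  · change y = tpow (𝕂.val y) * (tpow (-𝕂.val y) * y)
    rw [← mul_assoc, ← tpow_add, add_neg_cancel, tpow_zero, one_mul]

/-! ### Initial forms -/

/-- With `M` the tropical maximum at `u`, the rescaled coefficient of exponent `γ` has valuation `M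
- term γ u`. This is nonnegative on the support and vanishes exactly for the attained exponents, so
the reduction consists of their leading terms alone. -/
theorem exists_scaled_polynomial (F : MvPolynomial (Fin 2) 𝕂) {u : Fin 2 → ℝ}
    {α β : Fin 2 →₀ ℕ} (hαβ : α ≠ β) (h : (tropPoly F).attained u = {α, β}) :
    ∃ (G : MvPolynomial (Fin 2) valRing) (M : ℝ),
      (∀ x : Fin 2 → valRing, ((eval x G : valRing) : 𝕂) =
        tpow M * eval (fun i => tpow (-u i) * (x i : 𝕂)) F) ∧
      map res G = monomial α (F.coeff α).1.leadingCoeff + monomial β (F.coeff β).1.leadingCoeff := by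
  classical
  have hα : α ∈ (tropPoly F).attained u := by rw [h]; simp
  have hβ : β ∈ (tropPoly F).attained u := by rw [h]; simp
  set M : ℝ := (tropPoly F).term α u with hM
  let d : (Fin 2 →₀ ℕ) → ℝ := fun γ => M - (γ 0 * u 0 + γ 1 * u 1)
  have hterm : ∀ γ, (tropPoly F).term γ u =
      -(F.coeff γ).1.order + (γ 0 * u 0 + γ 1 * u 1) := fun γ => by
    simp [TropPoly.term, tropPoly, 𝕂.val, Fin.sum_univ_two]
  have hle : ∀ γ ∈ F.support, -d γ ≤ (F.coeff γ).1.order := by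
    intro γ hγ
    have := hα.2 γ hγ
    rw [hterm γ] at this
    simp only [d]
    linarith
  have hmem : ∀ γ, tpow (d γ) * F.coeff γ ∈ valRing := by
    intro γ
    by_cases hγ : γ ∈ F.support
    · change 0 ≤ HahnSeries.orderTop (tpow (d γ) * F.coeff γ).1
      rw [HahnSeries.le_orderTop_iff_forall]
      intro r hr
      have hr' : r < 0 := by exact_mod_cast hr
      rw [coeff_tpow_mul]
      have := hle γ hγ
      exact HahnSeries.coeff_eq_zero_of_lt_order (by linarith)
    · rw [notMem_support_iff.1 hγ, mul_zero]
      exact valRing.zero_mem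
  let g : (Fin 2 →₀ ℕ) → valRing := fun γ => ⟨tpow (d γ) * F.coeff γ, hmem γ⟩
  have hres : ∀ γ, res (g γ) = (F.coeff γ).1.coeff (-d γ) := fun γ => by
    change (tpow (d γ) * F.coeff γ).1.coeff 0 = _
    rw [coeff_tpow_mul, zero_sub]
  have hres1 : ∀ γ ∈ (tropPoly F).attained u, res (g γ) = (F.coeff γ).1.leadingCoeff := by
    intro γ hγ
    rw [hres, HahnSeries.leadingCoeff_eq]
    congr 1
    have := TropPoly.term_eq_of_mem_attained hγ hα
    rw [hterm γ, ← hM] at this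
    simp only [d]
    linarith
  have hres0 : ∀ γ ∈ F.support, γ ≠ α → γ ≠ β → res (g γ) = 0 := by
    intro γ hγ h1 h2
    have hnot : γ ∉ (tropPoly F).attained u := by rw [h]; simp [h1, h2]
    have hlt : (tropPoly F).term γ u < M := by
      by_contra hcon
      exact hnot ⟨hγ, fun δ hδ => (hα.2 δ hδ).trans (not_lt.1 hcon)⟩
    rw [hterm γ] at hlt
    rw [hres]
    refine HahnSeries.coeff_eq_zero_of_lt_order ?_
    simp only [d]
    linarith
  refine ⟨∑ γ ∈ F.support, monomial γ (g γ), M, fun x => ?_, ?_⟩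
  · rw [map_sum, eval_eq', Finset.mul_sum]
    rw [show ((∑ γ ∈ F.support, eval x (monomial γ (g γ)) : valRing) : 𝕂) =
      ∑ γ ∈ F.support, ((eval x (monomial γ (g γ)) : valRing) : 𝕂) from
        map_sum valRing.subtype _ _]
    refine Finset.sum_congr rfl fun γ _ => ?_
    rw [eval_monomial, Finsupp.prod_fintype _ _ (fun i => pow_zero _), Fin.prod_univ_two,
      Fin.prod_univ_two]
    change (tpow (d γ) * F.coeff γ) * ((x 0 : 𝕂) ^ γ 0 * (x 1 : 𝕂) ^ γ 1) = _
    rw [mul_pow, mul_pow, tpow_pow, tpow_pow]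
    have : tpow (d γ) = tpow M * (tpow (γ 0 * -u 0) * tpow (γ 1 * -u 1)) := by
      rw [← tpow_add, ← tpow_add]
      congr 1
      simp only [d]
      ring
    rw [this]
    ring
  · rw [map_sum]
    simp only [map_monomial]
    rw [Finset.sum_eq_add α β hαβ, hres1 α hα, hres1 β hβ]
    · rintro γ hγ ⟨h1, h2⟩
      rw [hres0 γ hγ h1 h2, monomial_zero]
    · exact fun hn => absurd hα.1 hn
    · exact fun hn => absurd hβ.1 hn

/-! ### Binomial initial forms and their Jacobian -/

theorem eval_binomial (ξ : Fin 2 → ℂ) (α : Fin 2 →₀ ℕ) (a : ℂ) :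
    eval ξ (monomial α a) = a * (ξ 0 ^ α 0 * ξ 1 ^ α 1) := by
  rw [eval_monomial, Finsupp.prod_fintype _ _ (fun i => pow_zero _), Fin.prod_univ_two]

theorem mul_eval_pderiv_monomial (ξ : Fin 2 → ℂ) (α : Fin 2 →₀ ℕ) (a : ℂ) (j : Fin 2) :
    ξ j * eval ξ (pderiv j (monomial α a)) = α j * eval ξ (monomial α a) := by
  rw [pderiv_monomial]
  rcases Nat.eq_zero_or_pos (α j) with h | h
  · simp [h]
  · have h1 : α = (α - Finsupp.single j 1) + Finsupp.single j 1 := by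
      rw [tsub_add_cancel_of_le]
      rwa [Finsupp.single_le_iff]
    have h2 : (monomial α a : MvPolynomial (Fin 2) ℂ) =
        monomial (α - Finsupp.single j 1) a * X j := by
      rw [X, monomial_mul, mul_one, ← h1]
    have h3 : eval ξ (monomial α a) = eval ξ (monomial (α - Finsupp.single j 1) a) * ξ j := by
      rw [h2, (eval ξ).map_mul, eval_X]
    rw [h3, eval_monomial, eval_monomial]
    ring

theorem eval_binomial_eq_zero_iff {ξ : Fin 2 → ℂ} (hξ : ∀ i, ξ i ≠ 0) {α β : Fin 2 →₀ ℕ}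
    {a b : ℂ} (ha : a ≠ 0) :
    eval ξ (monomial α a + monomial β b) = 0 ↔
      ξ 0 ^ ((α 0 : ℤ) - β 0) * ξ 1 ^ ((α 1 : ℤ) - β 1) = -b / a := by
  have h0 := pow_ne_zero (β 0) (hξ 0)
  have h1 := pow_ne_zero (β 1) (hξ 1)
  rw [map_add, eval_binomial, eval_binomial, zpow_sub₀ (hξ 0), zpow_sub₀ (hξ 1)]
  simp only [zpow_natCast]
  rw [div_mul_div_comm, div_eq_div_iff (mul_ne_zero h0 h1) ha, ← sub_eq_zero (b := -b * _)]
  constructor <;> intro h <;> linear_combination h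

/-- The logarithmic derivative `ξ j * ∂ j` multiplies a monomial by its exponent. At a zero of the
binomial the second term is minus the first, so it yields `a ξ^α * (α j - β j)`. The Jacobian is
therefore the determinant of the exponent differences up to nonzero factors. -/
theorem jacobian_binomials_ne_zero {ξ : Fin 2 → ℂ} (hξ : ∀ i, ξ i ≠ 0)
    {α β γ δ : Fin 2 →₀ ℕ} {a b c d : ℂ} (ha : a ≠ 0) (hc : c ≠ 0)
    (hab : eval ξ (monomial α a + monomial β b) = 0)
    (hcd : eval ξ (monomial γ c + monomial δ d) = 0)
    (hn : ((α 0 : ℤ) - β 0) * ((γ 1 : ℤ) - δ 1) - ((α 1 : ℤ) - β 1) * ((γ 0 : ℤ) - δ 0) ≠ 0) :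
    eval ξ (pderiv 0 (monomial α a + monomial β b)) *
        eval ξ (pderiv 1 (monomial γ c + monomial δ d)) -
      eval ξ (pderiv 1 (monomial α a + monomial β b)) *
        eval ξ (pderiv 0 (monomial γ c + monomial δ d)) ≠ 0 := by
  intro h
  simp only [map_add] at h hab hcd
  have hA : eval ξ (monomial α a) ≠ 0 := by
    rw [eval_binomial]
    exact mul_ne_zero ha (mul_ne_zero (pow_ne_zero _ (hξ 0)) (pow_ne_zero _ (hξ 1)))
  have hC : eval ξ (monomial γ c) ≠ 0 := by
    rw [eval_binomial]
    exact mul_ne_zero hc (mul_ne_zero (pow_ne_zero _ (hξ 0)) (pow_ne_zero _ (hξ 1)))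
  have key : eval ξ (monomial α a) * eval ξ (monomial γ c) *
      (((α 0 : ℂ) - β 0) * ((γ 1 : ℂ) - δ 1) - ((α 1 : ℂ) - β 1) * ((γ 0 : ℂ) - δ 0)) = 0 := by
    have eα := mul_eval_pderiv_monomial ξ α a
    have eβ := mul_eval_pderiv_monomial ξ β b
    have eγ := mul_eval_pderiv_monomial ξ γ c
    have eδ := mul_eval_pderiv_monomial ξ δ d
    have r1 : ∀ j, ξ j * (eval ξ (pderiv j (monomial α a)) + eval ξ (pderiv j (monomial β b))) =
        eval ξ (monomial α a) * ((α j : ℂ) - β j) := fun j => by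
      linear_combination eα j + eβ j + (β j : ℂ) * hab
    have r2 : ∀ j, ξ j * (eval ξ (pderiv j (monomial γ c)) + eval ξ (pderiv j (monomial δ d))) =
        eval ξ (monomial γ c) * ((γ j : ℂ) - δ j) := fun j => by
      linear_combination eγ j + eδ j + (δ j : ℂ) * hcd
    calc _ = (eval ξ (monomial α a) * ((α 0 : ℂ) - β 0)) *
          (eval ξ (monomial γ c) * ((γ 1 : ℂ) - δ 1)) -
          (eval ξ (monomial α a) * ((α 1 : ℂ) - β 1)) *
          (eval ξ (monomial γ c) * ((γ 0 : ℂ) - δ 0)) := by ring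
      _ = ξ 0 * ξ 1 * ((eval ξ (pderiv 0 (monomial α a)) + eval ξ (pderiv 0 (monomial β b))) *
          (eval ξ (pderiv 1 (monomial γ c)) + eval ξ (pderiv 1 (monomial δ d))) -
          (eval ξ (pderiv 1 (monomial α a)) + eval ξ (pderiv 1 (monomial β b))) *
          (eval ξ (pderiv 0 (monomial γ c)) + eval ξ (pderiv 0 (monomial δ d)))) := by
          rw [← r1 0, ← r1 1, ← r2 0, ← r2 1]; ring
      _ = 0 := by rw [h, mul_zero]
  refine hn ?_
  have := (mul_eq_zero.1 key).resolve_left (mul_ne_zero hA hC)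
  have h2 : ((((α 0 : ℤ) - β 0) * ((γ 1 : ℤ) - δ 1) -
      ((α 1 : ℤ) - β 1) * ((γ 0 : ℤ) - δ 0) : ℤ) : ℂ) = ((0 : ℤ) : ℂ) := by
    push_cast
    exact this
  exact Int.cast_injective h2

/-- The difference of two exponents. -/
def expDiff (α β : Fin 2 →₀ ℕ) : Fin 2 → ℤ := fun i => (α i : ℤ) - β i

/-- Taking leading coefficients identifies the common zeros of two polynomials above a point of
transverse intersection of the tropical curves with the solutions of the initial binomials. -/
theorem bijOn_leadingCoeff {F F' : MvPolynomial (Fin 2) 𝕂} {u : Fin 2 → ℝ}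
    {α β γ δ : Fin 2 →₀ ℕ} (hαβ : α ≠ β) (hγδ : γ ≠ δ)
    (h : (tropPoly F).attained u = {α, β}) (h' : (tropPoly F').attained u = {γ, δ})
    (hn : expDiff α β 0 * expDiff γ δ 1 - expDiff α β 1 * expDiff γ δ 0 ≠ 0) :
    Set.BijOn (fun (p : Fin 2 → 𝕂) i => (p i).1.leadingCoeff)
      {p ∈ torusZeros F ∩ torusZeros F' | tropPoint p = u}
      (binomialSolutions (expDiff α β) (expDiff γ δ)
        (-(F.coeff β).1.leadingCoeff / (F.coeff α).1.leadingCoeff)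
        (-(F'.coeff δ).1.leadingCoeff / (F'.coeff γ).1.leadingCoeff)) := by
  obtain ⟨G, M, hG, hGres⟩ := exists_scaled_polynomial F hαβ h
  obtain ⟨G', M', hG', hGres'⟩ := exists_scaled_polynomial F' hγδ h'
  have hlc : ∀ (F : MvPolynomial (Fin 2) 𝕂) (α : Fin 2 →₀ ℕ), α ∈ F.support →
      (F.coeff α).1.leadingCoeff ≠ 0 := fun F α hα =>
    HahnSeries.leadingCoeff_ne_zero.2 fun h0 => mem_support_iff.1 hα (Subtype.ext h0)
  have ha := hlc F α ((h ▸ Set.mem_insert _ _ : α ∈ (tropPoly F).attained u).1)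
  have hc := hlc F' γ ((h' ▸ Set.mem_insert _ _ : γ ∈ (tropPoly F').attained u).1)
  have hzero : ∀ (x : Fin 2 → valRing),
      (eval (fun i => tpow (-u i) * (x i : 𝕂)) F = 0 ↔ eval x G = 0) ∧
      (eval (fun i => tpow (-u i) * (x i : 𝕂)) F' = 0 ↔ eval x G' = 0) := by
    intro x
    constructor
    · rw [← ZeroMemClass.coe_eq_zero (x := eval x G), hG]
      exact ⟨fun h => by rw [h, mul_zero],
        fun h => (mul_eq_zero.1 h).resolve_left (tpow_ne_zero M)⟩
    · rw [← ZeroMemClass.coe_eq_zero (x := eval x G'), hG']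
      exact ⟨fun h => by rw [h, mul_zero],
        fun h => (mul_eq_zero.1 h).resolve_left (tpow_ne_zero M')⟩
  -- Lying above `u` prescribes the valuations, so such a point is `tpow (-u i)` times elements with
  -- nonzero residue, and these residues are its leading coefficients.
  have hS : ∀ p ∈ {p ∈ torusZeros F ∩ torusZeros F' | tropPoint p = u},
      ∃ x : Fin 2 → valRing, (∀ i, res (x i) ≠ 0) ∧ p = (fun i => tpow (-u i) * (x i : 𝕂)) ∧
        (fun i => (p i).1.leadingCoeff) = (fun i => res (x i)) ∧
        eval x G = 0 ∧ eval x G' = 0 := by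
    rintro p ⟨⟨⟨hp0, hpF⟩, -, hpF'⟩, hpu⟩
    choose x hx hpx using fun i => exists_eq_tpow_mul (hp0 i)
    have hval : ∀ i, 𝕂.val (p i) = -u i := fun i => by
      rw [← hpu]; simp [tropPoint]
    have hp : p = (fun i => tpow (-u i) * (x i : 𝕂)) := funext fun i => by
      rw [← hval i]; exact hpx i
    rw [hp] at hpF hpF'
    refine ⟨x, hx, hp, ?_, (hzero x).1.1 hpF, (hzero x).2.1 hpF'⟩
    funext i
    rw [hp]
    exact (val_tpow_mul (hx i)).2.1
  have hsol : ∀ ξ : Fin 2 → ℂ, ξ ∈ binomialSolutions (expDiff α β) (expDiff γ δ)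
        (-(F.coeff β).1.leadingCoeff / (F.coeff α).1.leadingCoeff)
        (-(F'.coeff δ).1.leadingCoeff / (F'.coeff γ).1.leadingCoeff) ↔
      (∀ i, ξ i ≠ 0) ∧ eval ξ (map res G) = 0 ∧ eval ξ (map res G') = 0 := by
    intro ξ
    refine and_congr_right fun hξ => ?_
    rw [hGres, hGres', eval_binomial_eq_zero_iff hξ ha, eval_binomial_eq_zero_iff hξ hc]
    rfl
  have hlift : ∀ ξ ∈ binomialSolutions (expDiff α β) (expDiff γ δ)
        (-(F.coeff β).1.leadingCoeff / (F.coeff α).1.leadingCoeff)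
        (-(F'.coeff δ).1.leadingCoeff / (F'.coeff γ).1.leadingCoeff),
      ∃! x : Fin 2 → valRing, (∀ i, res (x i) = ξ i) ∧ ∀ i, eval x (![G, G'] i) = 0 := by
    intro ξ hξ
    obtain ⟨h0, h1, h2⟩ := (hsol ξ).1 hξ
    refine existsUnique_lift ![G, G'] ξ ?_ ?_
    · intro i
      fin_cases i
      · exact h1
      · exact h2
    · rw [Matrix.det_fin_two]
      simp only [Matrix.of_apply, Matrix.cons_val_zero, Matrix.cons_val_one]
      rw [hGres] at h1 ⊢
      rw [hGres'] at h2 ⊢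
      exact jacobian_binomials_ne_zero h0 ha hc h1 h2 hn
  have hmaps : Set.MapsTo (fun (p : Fin 2 → 𝕂) i => (p i).1.leadingCoeff)
      {p ∈ torusZeros F ∩ torusZeros F' | tropPoint p = u}
      (binomialSolutions (expDiff α β) (expDiff γ δ)
        (-(F.coeff β).1.leadingCoeff / (F.coeff α).1.leadingCoeff)
        (-(F'.coeff δ).1.leadingCoeff / (F'.coeff γ).1.leadingCoeff)) := by
    intro p hp
    obtain ⟨x, hx, -, hpx, hxG, hxG'⟩ := hS p hp
    refine (hsol _).2 ?_
    change (∀ i, (fun i => (p i).1.leadingCoeff) i ≠ 0) ∧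
      eval (fun i => (p i).1.leadingCoeff) _ = 0 ∧ eval (fun i => (p i).1.leadingCoeff) _ = 0
    rw [hpx, ← res_eval, ← res_eval, hxG, hxG', map_zero]
    exact ⟨hx, rfl, rfl⟩
  refine ⟨hmaps, ?_, ?_⟩
  · intro p hp q hq hpq
    obtain ⟨x, -, hp', hpx, hxG, hxG'⟩ := hS p hp
    obtain ⟨y, -, hq', hqy, hyG, hyG'⟩ := hS q hq
    have hxy : x = y := by
      refine (hlift _ (hmaps hp)).unique ⟨fun i => (congrFun hpx i).symm, ?_⟩
        ⟨fun i => ?_, ?_⟩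
      · intro i
        fin_cases i
        · exact hxG
        · exact hxG'
      · exact (congrFun hqy i).symm.trans (congrFun hpq i).symm
      · intro i
        fin_cases i
        · exact hyG
        · exact hyG'
    rw [hp', hq', hxy]
  · intro ξ hξ
    obtain ⟨x, ⟨hx, hxG⟩, -⟩ := hlift ξ hξ
    have hx0 : ∀ i, res (x i) ≠ 0 := fun i => by rw [hx]; exact hξ.1 i
    have hne : ∀ i, tpow (-u i) * (x i : 𝕂) ≠ 0 := fun i => (val_tpow_mul (hx0 i)).2.2
    refine ⟨fun i => tpow (-u i) * (x i : 𝕂),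
      ⟨⟨⟨hne, (hzero x).1.2 (hxG 0)⟩, hne, (hzero x).2.2 (hxG 1)⟩, ?_⟩, ?_⟩
    · funext i
      rw [tropPoint, (val_tpow_mul (hx0 i)).1, neg_neg]
    · funext i
      rw [← hx]
      exact (val_tpow_mul (hx0 i)).2.1

end

section

open MvPolynomial 𝕂

/-! ### Conjugation of points -/

theorem conjPoint_involutive : Function.Involutive conjPoint := fun p =>
  funext fun i => conj_conj (p i)

theorem isRealPoint_iff {p : Fin 2 → 𝕂} : IsRealPoint p ↔ conjPoint p = p := by
  rw [funext_iff]
  exact forall_congr' fun i => isReal_iff_conj_eq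

theorem conj_ne_zero {x : 𝕂} (hx : x ≠ 0) : x.conj ≠ 0 := fun h =>
  hx (by rw [← conj_conj x, h]; exact map_zero conjHom)

theorem order_conj (x : 𝕂) : x.conj.1.order = x.1.order := by
  by_cases hx : x = 0
  · rw [hx]; exact congrArg (fun y : 𝕂 => y.1.order) (map_zero conjHom)
  · have hx' : x.1 ≠ 0 := fun h => hx (Subtype.ext h)
    refine order_eq_of_coeff ?_ fun r hr => ?_
    · rw [coeff_conj]
      exact (map_ne_zero _).2 (mt HahnSeries.coeff_order_eq_zero.1 hx')
    · rw [coeff_conj, HahnSeries.coeff_eq_zero_of_lt_order hr, map_zero]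

theorem leadingCoeff_conj (x : 𝕂) :
    x.conj.1.leadingCoeff = (starRingEnd ℂ) x.1.leadingCoeff := by
  rw [HahnSeries.leadingCoeff_eq, HahnSeries.leadingCoeff_eq, order_conj, coeff_conj]

theorem tropPoint_conjPoint (p : Fin 2 → 𝕂) : tropPoint (conjPoint p) = tropPoint p :=
  funext fun i => congrArg Neg.neg (order_conj (p i))

theorem conjPoint_mem_torusZeros {F : MvPolynomial (Fin 2) 𝕂} (hF : ∀ α, (F.coeff α).IsReal)
    {p : Fin 2 → 𝕂} (hp : p ∈ torusZeros F) : conjPoint p ∈ torusZeros F := by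
  refine ⟨fun i => conj_ne_zero (hp.1 i), ?_⟩
  have h1 : map conjHom F = F := by
    ext1 α
    rw [coeff_map]
    exact isReal_iff_conj_eq.1 (hF α)
  have h2 := MvPolynomial.map_eval conjHom p F
  rw [hp.2, map_zero, h1] at h2
  exact h2.symm

/-! ### Real phases -/

/-- The sign of a nonzero real number. -/
def unitSign (a : ℝ) : ℤˣ := if 0 < a then 1 else -1

theorem unitSign_mul {a b : ℝ} (ha : a ≠ 0) (hb : b ≠ 0) :
    unitSign (a * b) = unitSign a * unitSign b := by
  unfold unitSign
  rcases lt_or_gt_of_ne ha with ha | ha <;> rcases lt_or_gt_of_ne hb with hb | hb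
  · rw [if_pos (mul_pos_of_neg_of_neg ha hb), if_neg ha.not_gt, if_neg hb.not_gt]; rfl
  · rw [if_neg (mul_neg_of_neg_of_pos ha hb).not_gt, if_neg ha.not_gt, if_pos hb]; rfl
  · rw [if_neg (mul_neg_of_pos_of_neg ha hb).not_gt, if_neg hb.not_gt, if_pos ha]; rfl
  · rw [if_pos (mul_pos ha hb), if_pos ha, if_pos hb]; rfl

theorem unitSign_eq_iff {a b : ℝ} (ha : a ≠ 0) (hb : b ≠ 0) :
    unitSign a = unitSign b ↔ 0 < a * b := by
  have h : unitSign a = unitSign b ↔ unitSign (a * b) = 1 := by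
    rw [unitSign_mul ha hb, mul_eq_one_iff_eq_inv, Int.units_inv_eq_self]
  rw [h, unitSign]
  split_ifs with hab
  · simp [hab]
  · simp [hab]

/-- Links the coefficient signs, which determine the phases, to the sign of the product of the
right-hand sides of the binomial system: the two products differ by the square `(a * c) ^ 2`. -/
theorem unitSign_mul_eq_iff {a b c d : ℝ} (ha : a ≠ 0) (hb : b ≠ 0) (hc : c ≠ 0) (hd : d ≠ 0) :
    unitSign a * unitSign b = unitSign c * unitSign d ↔ 0 < (-b / a) * (-d / c) := by
  rw [← unitSign_mul ha hb, ← unitSign_mul hc hd,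
    unitSign_eq_iff (mul_ne_zero ha hb) (mul_ne_zero hc hd)]
  have : (a * b) * (c * d) = ((-b / a) * (-d / c)) * (a * c) ^ 2 := by
    field_simp
  rw [this]
  exact mul_pos_iff_of_pos_right (by positivity)

/-- Nonzero parallel vectors over the field with two elements are equal, as 1 is the only nonzero
scalar. -/
theorem zmod_two_eq_of_det_eq_zero : ∀ v₀ v₁ w₀ w₁ : ZMod 2, ¬ (v₀ = 0 ∧ v₁ = 0) →
    ¬ (w₀ = 0 ∧ w₁ = 0) → v₀ * w₁ - v₁ * w₀ = 0 → v₀ = w₀ ∧ v₁ = w₁ := by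
  decide

theorem not_cast_zmod_two_eq_zero {v₀ v₁ : ℤ} (h : Int.gcd v₀ v₁ = 1) :
    ¬ ((v₀ : ZMod 2) = 0 ∧ (v₁ : ZMod 2) = 0) := by
  rintro ⟨h0, h1⟩
  have h2 := Int.dvd_coe_gcd ((ZMod.intCast_zmod_eq_zero_iff_dvd _ 2).1 h0)
    ((ZMod.intCast_zmod_eq_zero_iff_dvd _ 2).1 h1)
  rw [h] at h2
  norm_num at h2

/-- The exponent of `-1` that compares the signs at the two copies by `ε` of `α` and `β`. -/
def signExponent (α β : Fin 2 →₀ ℕ) (ε : Fin 2 → ZMod 2) : ℕ :=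
  ((ε 0).val * α 0 + (ε 1).val * α 1) + ((ε 0).val * β 0 + (ε 1).val * β 1)

theorem cast_signExponent (α β : Fin 2 →₀ ℕ) (ε : Fin 2 → ZMod 2) :
    (signExponent α β ε : ZMod 2) =
      ε 0 * (expDiff α β 0 : ℤ) + ε 1 * (expDiff α β 1 : ℤ) := by
  simp only [signExponent, expDiff]
  push_cast
  simp only [ZMod.natCast_val, ZMod.cast_id', id, sub_eq_add_neg, ZMod.neg_eq_self_mod_two]
  ring

theorem extendSign_ne_iff (δ : (Fin 2 →₀ ℕ) → ℤˣ) (α β : Fin 2 →₀ ℕ) (ε : Fin 2 → ZMod 2) :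
    extendSign δ ε α ≠ extendSign δ ε β ↔ (-1 : ℤˣ) ^ signExponent α β ε = -(δ α * δ β) := by
  unfold extendSign signExponent
  generalize (ε 0).val * α 0 + (ε 1).val * α 1 = k
  generalize (ε 0).val * β 0 + (ε 1).val * β 1 = l
  rw [pow_add]
  generalize (-1 : ℤˣ) ^ k = x
  generalize (-1 : ℤˣ) ^ l = y
  generalize δ α = a
  generalize δ β = b
  rcases Int.units_eq_one_or x with rfl | rfl <;> rcases Int.units_eq_one_or y with rfl | rfl <;>
  rcases Int.units_eq_one_or a with rfl | rfl <;> rcases Int.units_eq_one_or b with rfl | rfl <;>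
  decide

theorem exists_signExponent {α β : Fin 2 →₀ ℕ}
    (h : Int.gcd (expDiff α β 0) (expDiff α β 1) = 1) (σ : ℤˣ) :
    ∃ ε, (-1 : ℤˣ) ^ signExponent α β ε = σ := by
  rcases Int.units_eq_one_or σ with rfl | rfl
  · exact ⟨0, by simp [signExponent]⟩
  have hne := not_cast_zmod_two_eq_zero h
  have hone : ∃ ε, (signExponent α β ε : ZMod 2) = 1 := by
    simp only [cast_signExponent]
    generalize ((expDiff α β 0 : ℤ) : ZMod 2) = x at hne
    generalize ((expDiff α β 1 : ℤ) : ZMod 2) = y at hne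
    revert x y
    decide
  obtain ⟨ε, hε⟩ := hone
  exact ⟨ε, (ZMod.natCast_eq_one_iff_odd.1 hε).neg_one_pow⟩

/-- An even determinant makes the two exponent differences equal modulo 2, so both sets are level
sets of one linear form on `(ℤ/2)²`. Primitivity makes this form nonzero, hence every level is
nonempty and equal sets have equal levels. -/
theorem setOf_extendSign_ne_eq_iff (σ τ : (Fin 2 →₀ ℕ) → ℤˣ) {α β γ δ : Fin 2 →₀ ℕ}
    (hv : Int.gcd (expDiff α β 0) (expDiff α β 1) = 1)
    (hw : Int.gcd (expDiff γ δ 0) (expDiff γ δ 1) = 1)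
    (hn : Even (expDiff α β 0 * expDiff γ δ 1 - expDiff α β 1 * expDiff γ δ 0)) :
    {ε | extendSign σ ε α ≠ extendSign σ ε β} = {ε | extendSign τ ε γ ≠ extendSign τ ε δ} ↔
      σ α * σ β = τ γ * τ δ := by
  have hcast := (ZMod.intCast_zmod_eq_zero_iff_dvd _ 2).2 hn.two_dvd
  push_cast at hcast
  obtain ⟨h0, h1⟩ := zmod_two_eq_of_det_eq_zero _ _ _ _ (not_cast_zmod_two_eq_zero hv)
    (not_cast_zmod_two_eq_zero hw) hcast
  have hpow : ∀ ε, (-1 : ℤˣ) ^ signExponent α β ε = (-1) ^ signExponent γ δ ε := fun ε => by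
    refine neg_one_pow_congr ?_
    rw [← ZMod.natCast_eq_zero_iff_even, ← ZMod.natCast_eq_zero_iff_even, cast_signExponent,
      cast_signExponent, h0, h1]
  simp only [extendSign_ne_iff, hpow]
  constructor
  · intro h
    obtain ⟨ε, hε⟩ := exists_signExponent hw (-(σ α * σ β))
    have h2 : ε ∈ {ε | (-1 : ℤˣ) ^ signExponent γ δ ε = -(τ γ * τ δ)} := h ▸ hε
    exact neg_injective (hε.symm.trans h2)
  · intro h
    rw [h]

theorem TropPoly.phase_eq_of_attainedOn_eq {P : TropPoly} {e : Set (Fin 2 → ℝ)}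
    {α β : Fin 2 →₀ ℕ} (h : P.attainedOn e = {α, β}) (σ : (Fin 2 →₀ ℕ) → ℤˣ) :
    P.phase σ e = {ε | extendSign σ ε α ≠ extendSign σ ε β} := by
  ext ε
  simp only [phase, h, Set.mem_ofPred_eq, Set.mem_insert_iff, Set.mem_singleton_iff]
  constructor
  · rintro ⟨x, rfl | rfl, y, rfl | rfl, hxy⟩
    · exact absurd rfl hxy
    · exact hxy
    · exact hxy.symm
    · exact absurd rfl hxy
  · exact fun hxy => ⟨α, Or.inl rfl, β, Or.inr rfl, hxy⟩

/-! ### Counting -/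

/-- Conjugation acts freely on the non-real points, so the total and the number of real points
determine the number of pairs. Both directions of the equivalences in the main theorem then become
arithmetic. -/
theorem consistsOf_iff {S : Set (Fin 2 → 𝕂)} (hS : S.Finite) (hconj : ∀ p ∈ S, conjPoint p ∈ S)
    {m r : ℕ} (hm : S.ncard = m) (hr : {p ∈ S | IsRealPoint p}.ncard = r) (r' k : ℕ) :
    ConsistsOf S r' k ↔ r' = r ∧ 2 * k + r = m := by
  have hN : {p ∈ S | ¬ IsRealPoint p}.Finite := hS.subset (Set.sep_subset _ _)
  have h1 := ncard_pairs_mul_two conjPoint_involutive hN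
    (fun p hp => ⟨hconj p hp.1, fun h => hp.2 (by
      rw [isRealPoint_iff, conjPoint_involutive p] at h
      exact isRealPoint_iff.2 h.symm)⟩)
    (fun p hp h => hp.2 (isRealPoint_iff.2 h))
  have h2 : {T : Set (Fin 2 → 𝕂) | ∃ p ∈ {p ∈ S | ¬ IsRealPoint p}, T = {p, conjPoint p}} =
      {T | ∃ p ∈ S, ¬ IsRealPoint p ∧ T = {p, conjPoint p}} := by
    ext T
    simp only [Set.mem_ofPred_eq, and_assoc]
  have h3 : {p ∈ S | IsRealPoint p}.ncard + {p ∈ S | ¬ IsRealPoint p}.ncard = S.ncard := by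
    rw [← Set.ncard_union_eq (Set.disjoint_left.2 fun p h h' => h'.2 h.2)
      (hS.subset (Set.sep_subset _ _)) hN]
    congr 1
    ext p
    simp only [Set.mem_union, Set.mem_ofPred_eq]
    tauto
  rw [h2] at h1
  rw [← h1, hr, hm] at h3
  unfold ConsistsOf
  rw [hr]
  constructor
  · rintro ⟨-, -, h4, h5⟩
    rw [h5] at h3
    omega
  · rintro ⟨h4, h5⟩
    exact ⟨hS, hconj, h4.symm, by omega⟩

/-- The number of the common zeros above a transverse intersection point of the tropical curves,
and of the real ones among them. -/
theorem ncard_intersection {F F' : MvPolynomial (Fin 2) 𝕂} (hF : ∀ α, (F.coeff α).IsReal)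
    (hF' : ∀ α, (F'.coeff α).IsReal) {u : Fin 2 → ℝ} {e e' : Set (Fin 2 → ℝ)}
    {α β γ δ : Fin 2 →₀ ℕ} (h : (tropPoly F).IsDualPair e u α β)
    (h' : (tropPoly F').IsDualPair e' u γ δ)
    (hn : expDiff α β 0 * expDiff γ δ 1 - expDiff α β 1 * expDiff γ δ 0 ≠ 0) :
    {p ∈ torusZeros F ∩ torusZeros F' | tropPoint p = u}.ncard =
      (expDiff α β 0 * expDiff γ δ 1 - expDiff α β 1 * expDiff γ δ 0).natAbs ∧
    {p ∈ {p ∈ torusZeros F ∩ torusZeros F' | tropPoint p = u} | IsRealPoint p}.ncard =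
      if Odd (expDiff α β 0 * expDiff γ δ 1 - expDiff α β 1 * expDiff γ δ 0) then 1 else
        if (F.coeff α).sign * (F.coeff β).sign = (F'.coeff γ).sign * (F'.coeff δ).sign then 2
        else 0 := by
  have hne : ∀ {α β : Fin 2 →₀ ℕ}, Int.gcd (expDiff α β 0) (expDiff α β 1) = 1 → α ≠ β := by
    rintro α β h rfl
    simp [expDiff] at h
  have hv : Int.gcd (expDiff α β 0) (expDiff α β 1) = 1 := h.gcd_eq_one
  have hw : Int.gcd (expDiff γ δ 0) (expDiff γ δ 1) = 1 := h'.gcd_eq_one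
  have hbij := bijOn_leadingCoeff (hne hv) (hne hw) h.attained_eq h'.attained_eq hn
  have hlc : ∀ {F : MvPolynomial (Fin 2) 𝕂} (_ : ∀ α, (F.coeff α).IsReal) {α : Fin 2 →₀ ℕ},
      α ∈ (tropPoly F).attained u → ∃ a : ℝ, a ≠ 0 ∧ (F.coeff α).1.leadingCoeff = a ∧
        (F.coeff α).sign = unitSign a := by
    intro F hF α hα
    have h0 : (F.coeff α).1.leadingCoeff ≠ 0 :=
      HahnSeries.leadingCoeff_ne_zero.2 fun h0 => mem_support_iff.1 hα.1 (Subtype.ext h0)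
    have him : (F.coeff α).1.leadingCoeff = ((F.coeff α).1.leadingCoeff.re : ℂ) := by
      refine Complex.ext rfl ?_
      rw [Complex.ofReal_im, HahnSeries.leadingCoeff_eq]
      exact hF α _
    refine ⟨_, fun hre => h0 ?_, him, rfl⟩
    rw [him, hre, Complex.ofReal_zero]
  obtain ⟨a, ha, haF, hsa⟩ := hlc hF (α := α) (by rw [h.attained_eq]; simp)
  obtain ⟨b, hb, hbF, hsb⟩ := hlc hF (α := β) (by rw [h.attained_eq]; simp)
  obtain ⟨c, hc, hcF, hsc⟩ := hlc hF' (α := γ) (by rw [h'.attained_eq]; simp)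
  obtain ⟨d, hd, hdF, hsd⟩ := hlc hF' (α := δ) (by rw [h'.attained_eq]; simp)
  rw [haF, hbF, hcF, hdF] at hbij
  rw [hsa, hsb, hsc, hsd]
  have hp : -b / a ≠ 0 := div_ne_zero (neg_ne_zero.2 hb) ha
  have hq : -d / c ≠ 0 := div_ne_zero (neg_ne_zero.2 hd) hc
  have hpc : -(b : ℂ) / a = ((-b / a : ℝ) : ℂ) := by push_cast; rfl
  have hqc : -(d : ℂ) / c = ((-d / c : ℝ) : ℂ) := by push_cast; rfl
  rw [hpc, hqc] at hbij
  constructor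
  · rw [← ncard_binomialSolutions (v := expDiff α β) (w := expDiff γ δ)
      (Complex.ofReal_ne_zero.2 hp) (Complex.ofReal_ne_zero.2 hq) hv hn, ← hbij.image_eq,
      hbij.injOn.ncard_image]
  · have h2 := ncard_binomialSolutions_real hp hq hv hw hn
    simp only [unitSign_mul_eq_iff ha hb hc hd]
    rw [← h2, ← (hbij.injOn.mono (Set.sep_subset _ _)).ncard_image]
    congr 1
    ext ξ
    constructor
    · rintro ⟨p, ⟨hp, hreal⟩, rfl⟩
      refine ⟨hbij.mapsTo hp, fun i => ?_⟩
      change ((p i).1.leadingCoeff).im = 0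
      rw [HahnSeries.leadingCoeff_eq]
      exact hreal i _
    · rintro ⟨hξ, him⟩
      obtain ⟨p, hp, rfl⟩ := hbij.surjOn hξ
      -- The conjugate of `p` lies in the same set and has the same, real, leading coefficients;
      -- injectivity makes `p` real.
      refine ⟨p, ⟨hp, isRealPoint_iff.2 (hbij.injOn ?_ hp ?_)⟩, rfl⟩
      · exact ⟨⟨conjPoint_mem_torusZeros hF hp.1.1, conjPoint_mem_torusZeros hF' hp.1.2⟩,
          (tropPoint_conjPoint p).trans hp.2⟩
      · funext i
        exact (leadingCoeff_conj (p i)).trans (Complex.conj_eq_iff_im.2 (him i))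

end

end RealTropical

end

/-! ### The intersection theorem -/

theorem mainTheorem8 (X X' : RealTropical.RealTropicalCurve)
    (e e' : Set (Fin 2 → ℝ)) (u : Fin 2 → ℝ)
    (hu : RealTropical.IsTransverseAt X.poly X'.poly e e' u)
    (m : ℕ) (hm : 1 ≤ m) (hmult : RealTropical.tropMult X.poly X'.poly u = m)
    (Z Z' : Set (Fin 2 → RealTropical.𝕂))
    (hZ : RealTropical.IsRealisation X Z) (hZ' : RealTropical.IsRealisation X' Z') :
    {p ∈ Z ∩ Z' | RealTropical.tropPoint p = u}.ncard = m ∧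
    (Even m →
      (RealTropical.ConsistsOf {p ∈ Z ∩ Z' | RealTropical.tropPoint p = u} 2 ((m - 2) / 2) ↔
        X.phase e = X'.phase e') ∧
      (RealTropical.ConsistsOf {p ∈ Z ∩ Z' | RealTropical.tropPoint p = u} 0 (m / 2) ↔
        X.phase e ≠ X'.phase e')) ∧
    (Odd m →
      RealTropical.ConsistsOf {p ∈ Z ∩ Z' | RealTropical.tropPoint p = u} 1 ((m - 1) / 2)) := by
  obtain ⟨-, he, hue, he', hue'⟩ := hu
  obtain ⟨F, hF, rfl, htrop, hphase⟩ := hZ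
  obtain ⟨F', hF', rfl, htrop', hphase'⟩ := hZ'
  -- The multiplicity is measured with the given tropical polynomials, whereas the count uses those
  -- of `F` and `F'`. Sharing edges and weights, they have the same primitive difference vector on
  -- each edge up to sign, and the sign does not affect the absolute value of the determinant.
  have hpair : ∀ (X : RealTropical.RealTropicalCurve) (F : MvPolynomial (Fin 2) RealTropical.𝕂)
      (e : Set (Fin 2 → ℝ)), RealTropical.tropicalisation F = X.poly.curve → e ∈ X.poly.edges →
      u ∈ intrinsicInterior ℝ e → ∃ α β γ δ, X.poly.IsDualPair e u α β ∧
        (RealTropical.tropPoly F).IsDualPair e u γ δ ∧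
        ∃ k : ℤ, (k = 1 ∨ k = -1) ∧ (α 0 : ℤ) - β 0 = k * RealTropical.expDiff γ δ 0 ∧
          (α 1 : ℤ) - β 1 = k * RealTropical.expDiff γ δ 1 := by
    intro X F e htrop he hue
    have h1 : (RealTropical.tropPoly F).edges = X.poly.edges :=
      congrArg RealTropical.WeightedComplex.edges htrop
    have h2 : (RealTropical.tropPoly F).weight = X.poly.weight :=
      congrArg RealTropical.WeightedComplex.weight htrop
    have hw := X.nonSingular.2 e he
    obtain ⟨α, β, h⟩ := RealTropical.TropPoly.exists_isDualPair he hw hue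
    obtain ⟨γ, δ, h'⟩ := RealTropical.TropPoly.exists_isDualPair (P := RealTropical.tropPoly F)
      (h1 ▸ he) (by rw [h2]; exact hw) hue
    exact ⟨α, β, γ, δ, h, h', h'.eq_or_eq_neg he.1 h⟩
  obtain ⟨α₁, β₁, α, β, h1, h, k, hk, hk0, hk1⟩ := hpair X F e htrop he hue
  obtain ⟨γ₁, δ₁, γ, δ, h1', h', k', hk', hk0', hk1'⟩ := hpair X' F' e' htrop' he' hue'
  obtain ⟨n, hndef⟩ : ∃ n, n = RealTropical.expDiff α β 0 * RealTropical.expDiff γ δ 1 -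
    RealTropical.expDiff α β 1 * RealTropical.expDiff γ δ 0 := ⟨_, rfl⟩
  have hmn : (m : ℤ) = |n| := by
    rw [RealTropical.tropMult_eq_abs_det h1.attained_eq h1'.attained_eq, hk0, hk1, hk0', hk1'] at hmult
    have h2 : (m : ℤ) = |k * k' * n| := by
      have h3 : ((m : ℤ) : ℝ) = ((|k * k' * n| : ℤ) : ℝ) := by
        rw [Int.cast_natCast, ← hmult]
        congr 2
        rw [hndef]
        ring
      exact Int.cast_injective h3
    rw [h2]
    rcases hk with rfl | rfl <;> rcases hk' with rfl | rfl <;> simp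
  have hmn' : n.natAbs = m := by
    rw [Int.abs_eq_natAbs] at hmn
    exact_mod_cast hmn.symm
  have hn : n ≠ 0 := by
    rintro rfl
    simp at hmn
    omega
  have hcard := RealTropical.ncard_intersection hF hF' h h' (hndef ▸ hn)
  rw [← hndef, hmn'] at hcard
  obtain ⟨hcard, hreal⟩ := hcard
  -- An infinite set has `ncard` zero, so `m ≥ 1` yields finiteness.
  have hfin : {p ∈ RealTropical.torusZeros F ∩ RealTropical.torusZeros F' |
      RealTropical.tropPoint p = u}.Finite := Set.finite_of_ncard_ne_zero (by omega)
  have hconj : ∀ p ∈ {p ∈ RealTropical.torusZeros F ∩ RealTropical.torusZeros F' |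
      RealTropical.tropPoint p = u}, RealTropical.conjPoint p ∈
      {p ∈ RealTropical.torusZeros F ∩ RealTropical.torusZeros F' |
        RealTropical.tropPoint p = u} := fun p hp =>
    ⟨⟨RealTropical.conjPoint_mem_torusZeros hF hp.1.1,
      RealTropical.conjPoint_mem_torusZeros hF' hp.1.2⟩,
      (RealTropical.tropPoint_conjPoint p).trans hp.2⟩
  refine ⟨hcard, fun hev => ?_, fun hodd => ?_⟩
  · have hevn : Even n := by rw [← Int.natAbs_even, hmn']; exact hev
    have hph : X.phase e = X'.phase e' ↔ (F.coeff α).sign * (F.coeff β).sign =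
        (F'.coeff γ).sign * (F'.coeff δ).sign := by
      rw [hphase e he, hphase' e' he', RealTropical.TropPoly.phase_eq_of_attainedOn_eq
        h.attainedOn_eq, RealTropical.TropPoly.phase_eq_of_attainedOn_eq h'.attainedOn_eq]
      exact RealTropical.setOf_extendSign_ne_eq_iff (fun α => (F.coeff α).sign)
        (fun α => (F'.coeff α).sign) h.gcd_eq_one h'.gcd_eq_one (hndef ▸ hevn)
    rw [if_neg (Int.not_odd_iff_even.2 hevn)] at hreal
    obtain ⟨m', hm'⟩ := hev
    by_cases hX : X.phase e = X'.phase e'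
    · rw [if_pos (hph.1 hX)] at hreal
      rw [RealTropical.consistsOf_iff hfin hconj hcard hreal,
        RealTropical.consistsOf_iff hfin hconj hcard hreal]
      exact ⟨iff_of_true (by omega) hX, iff_of_false (by omega) (not_not.2 hX)⟩
    · rw [if_neg (mt hph.2 hX)] at hreal
      rw [RealTropical.consistsOf_iff hfin hconj hcard hreal,
        RealTropical.consistsOf_iff hfin hconj hcard hreal]
      exact ⟨iff_of_false (by omega) hX, iff_of_true (by omega) hX⟩
  · have hoddn : Odd n := by rw [← Int.natAbs_odd, hmn']; exact hodd
    rw [if_pos hoddn] at hreal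
    rw [RealTropical.consistsOf_iff hfin hconj hcard hreal]
    obtain ⟨m', hm'⟩ := hodd
    omega
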